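/- **Setting.** Let $Y=X\beta+W$ with $X$ a real $n\times k$ matrix, $\beta\in\mathbb R^k$, and let $\{1,\dots,k\}$ be partitioned into $p$ nonempty groups $\mathcal G_1,\dots,\mathcal G_p$ of sizes $t_1,\dots,t_p$; an index $\ell$ is written $\ell=(j,t)$ where $j$ is the index of its group and $t\in\{1,\dots,t_j\}$ its rank inside the group. Write $\|u\|_{\mathcal G_j,1}=\sum_{\ell\in\mathcal G_j}|u_\ell|$, $\|u\|_{\mathcal G_j,2}^2=\sum_{\ell\in\mathcal G_j}u_\ell^2$, $x\vee y=\max(x,y)$, $x\wedge y=\min(x,y)$, $t^*=\max_j t_j$. Given normalising constants $n_\ell>0$, put $\tilde X_{i\ell}=X_{i\ell}/\sqrt{n_\ell}$, $\alpha_\ell=\sqrt{n_\ell}\,\beta_\ell$, $\Gamma=\tilde X^{t}\tilde X$, $$\gamma_{BT}=\sup_{t\ne t'}|\Gamma_{(j,t)(j',t')}|,\qquad \gamma_{BG}=\sup_{j\neq j',\,t}|\Gamma_{(j,t)(j',t)}|$$ (the suprema are over all such pairs of indices, those over an empty set being $0$), $\tau^*=t^*\gamma_{BT}+\gamma_{BG}$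 and $r^*=t^*\gamma_{BT}^2+\gamma_{BG}^2$. Let $0<\nu<1$, $0<q\le 1$, $M>0$, $\sigma>0$, $v_n>0$, $0<a<b$, and assume - (A1) $a\,v_n\le n_\ell\le b\,v_n$ for all $\ell$; - (A2) $\Gamma_{\ell\ell}=1$ for all $\ell$; - (A2') $\tau^*\le\nu$; - (A3) $\sum_{j=1}^p\|\alpha\|_{\mathcal G_j,1}^q\le M^q v_n^{q/2}$; - (A4) the coordinates of $W$ are i.i.d. $\mathcal N(0,\sigma^2)$. **GR-LOL estimator** with thresholds $\lambda_n(1),\lambda_n(2)$. Let $R_\ell=\sum_iY_i\tilde X_{i\ell}$, $\rho_j=\|R\|_{\mathcal G_j,2}$ and $N^*=\lfloor\nu/\tau^*\rfloor$ ($N^*=\infty$ if $\tau^*=0$). The set $\mathcal B$ of leaders consists of the groups $j$ with $\rho_j\ge\lambda_n(1)$ and $\rho_j\geq\rho_{(N^*)}$, the $N^*$-th largest of $\rho_1,\dots,\rho_p$ (no restriction if $N^*>p$). Let $\hat\beta$ be the least squares estimator $[X_{\mathcal G_{\mathcal B}}^tX_{\mathcal G_{\mathcal B}}]^{-1}X_{\mathcal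 G_{\mathcal B}}^tY$ on the columns $X_{\mathcal G_{\mathcal B}}$ of $X$ with index in $\mathcal G_{\mathcal B}=\bigcup_{j\in\mathcal B}\mathcal G_j$, extended by $0$. Finally $\hat\beta^*_\ell=\hat\beta_\ell\,\mathbf 1\{\|\hat\beta\|_{\mathcal G_j,2}\ge\lambda_n(2)/\sqrt{n_\ell}\}$ for $\ell=(j,t)$. **Theorem.** Put $$\lambda^*=\sigma\bigl(M^2v_nr^*\vee(t^*\vee\log p)(1+\nu)\bigr)^{1/2},\qquad \lambda_n(2)=c_2\lambda^*,\qquad \lambda_n(1)=c_1\lambda^*\vee\frac{2Mv_n^{1/2}\tau^*}{\nu},$$ where $c_1>c_2$, $c_2\ge5\sqrt\kappa$, $c_1\ge4+\nu^{-1/q}$ and $$\kappa=(1-\nu)^{-1}\vee4(1-\nu)^{-2}\vee2(2\nu^2-\nu+3)(1-\nu)^{-3}.$$ Let $v_0>0$ and, in case $\sigma>1$, suppose moreover $v_n\ge v_0$. Then there is a constant $C>0$, depending only on $c_1,c_2,\nu,M,\sigma,a$ and $v_0$, such that $$E\|\hat\beta^*-\beta\|_2^2\le C\Bigl[\frac{t^*\vee\log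 p}{v_n}\vee(\tau^*)^2\Bigr]^{1-q/2}$$ as soon as $$p\le c_a^{-1}v_n^{q/2}(\lambda^*)^{-q}\exp\bigl(c_b(\lambda^*)^2(1\wedge(r^*)^{-1})\bigr),$$ where $c_a=M^{-q}\bigl(\tfrac94c_1^2\vee3\kappa\bigr)$, $c_b=\frac{c_1^2}{64(1+\nu)}\wedge\frac{c_2^2}{192\kappa}$ and $(r^*)^{-1}=\infty$ if $r^*=0$. -/

import Mathlib

open scoped NNReal ENNReal Matrix
open MeasureTheory ProbabilityTheory

namespace GRLOL

noncomputable section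

/-- The regressors are split into `p` groups; group `j` has `t j` elements, and a regressor is
registered as the pair (index of its group, rank inside its group). Ranks start at `0` here. -/
abbrev Idx {p : ℕ} (t : Fin p → ℕ) : Type := (j : Fin p) × Fin (t j)

/-- The `l1`-norm of the restriction of `u` to the group `j`. -/
def groupNorm1 {p : ℕ} {t : Fin p → ℕ} (u : Idx t → ℝ) (j : Fin p) : ℝ :=
  ∑ s : Fin (t j), |u ⟨j, s⟩|

/-- The `l2`-norm of the restriction of `u` to the group `j`. -/
def groupNorm2 {p : ℕ} {t : Fin p → ℕ} (u : Idx t → ℝ) (j : Fin p) : ℝ :=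
  Real.sqrt (∑ s : Fin (t j), u ⟨j, s⟩ ^ 2)

/-- The normalised design `X i l / √(n_l)`; the vector of normalising constants is `nrm`. -/
def normDesign {n p : ℕ} {t : Fin p → ℕ} (nrm : Idx t → ℝ)
    (X : Matrix (Fin n) (Idx t) ℝ) : Matrix (Fin n) (Idx t) ℝ :=
  Matrix.of fun i l => X i l / Real.sqrt (nrm l)

/-- The Gram matrix of the normalised design. -/
def gram {n p : ℕ} {t : Fin p → ℕ} (nrm : Idx t → ℝ)
    (X : Matrix (Fin n) (Idx t) ℝ) : Matrix (Idx t) (Idx t) ℝ :=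
  (normDesign nrm X)ᵀ * normDesign nrm X

/-- Largest absolute entry of `Γ` at two regressors of different ranks
(`0` if there are none). -/
def gammaBT {p : ℕ} {t : Fin p → ℕ} (Γ : Matrix (Idx t) (Idx t) ℝ) : ℝ :=
  (((Finset.univ : Finset (Idx t × Idx t)).filter
    (fun x => (x.1.2 : ℕ) ≠ (x.2.2 : ℕ))).sup (fun x => ‖Γ x.1 x.2‖₊) : ℝ≥0)

/-- Largest absolute entry of `Γ` at two regressors of the same rank in different groups
(`0` if there are none). -/
def gammaBG {p : ℕ} {t : Fin p → ℕ} (Γ : Matrix (Idx t) (Idx t) ℝ) : ℝ :=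
  (((Finset.univ : Finset (Idx t × Idx t)).filter
    (fun x => x.1.1 ≠ x.2.1 ∧ (x.1.2 : ℕ) = (x.2.2 : ℕ))).sup (fun x => ‖Γ x.1 x.2‖₊) : ℝ≥0)

/-- The size of the largest group. -/
def tStar {p : ℕ} (t : Fin p → ℕ) : ℕ := Finset.univ.sup t

/-- The group coherence `τ*`. -/
def tauStar {p : ℕ} {t : Fin p → ℕ} (Γ : Matrix (Idx t) (Idx t) ℝ) : ℝ :=
  (tStar t : ℝ) * gammaBT Γ + gammaBG Γ

/-- The quadratic indicator `r*`. -/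
def rStar {p : ℕ} {t : Fin p → ℕ} (Γ : Matrix (Idx t) (Idx t) ℝ) : ℝ :=
  (tStar t : ℝ) * gammaBT Γ ^ 2 + gammaBG Γ ^ 2

/-- The quantity `t* ∨ log p`. -/
def sizeLog {p : ℕ} (t : Fin p → ℕ) : ℝ := max (tStar t : ℝ) (Real.log p)

/-! ### The estimator -/

/-- The integer part of the bound `N* = ν / τ*` on the number of leaders;
if `τ* = 0`, the bound is infinite, so that all `p` groups are allowed. -/
def numLeaders (p : ℕ) (ν τ : ℝ) : ℕ := if τ = 0 then p else ⌊ν / τ⌋₊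

/-- `R_l = ∑ i, Y_i X̃_{il}`. -/
def corr {n p : ℕ} {t : Fin p → ℕ} (nrm : Idx t → ℝ)
    (X : Matrix (Fin n) (Idx t) ℝ) (Y : Fin n → ℝ) : Idx t → ℝ :=
  fun l => ∑ i, Y i * normDesign nrm X i l

open Classical in
/-- The leading groups among the values `ρ j`: those at least as large as both the threshold
`l₁` and the `N`-th largest value, the latter meaning that fewer than `N` of the values are
strictly larger. -/
def leaders {p : ℕ} (N : ℕ) (l₁ : ℝ) (ρ : Fin p → ℝ) : Finset (Fin p) :=
  Finset.univ.filter fun j =>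
    l₁ ^ 2 ≤ ρ j ^ 2 ∧ (Finset.univ.filter fun i => ρ j ^ 2 < ρ i ^ 2).card < N

/-- The columns of `X` in the groups of `B`. -/
def colsOf {n p : ℕ} {t : Fin p → ℕ} (X : Matrix (Fin n) (Idx t) ℝ) (B : Finset (Fin p)) :
    Matrix (Fin n) {l : Idx t // l.1 ∈ B} ℝ :=
  X.submatrix id Subtype.val

/-- Least squares on the columns in the groups of `B`, extended by zero. -/
def olsOn {n p : ℕ} {t : Fin p → ℕ} (X : Matrix (Fin n) (Idx t) ℝ) (Y : Fin n → ℝ)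
    (B : Finset (Fin p)) : Idx t → ℝ :=
  fun l => if h : l.1 ∈ B then
    ((((colsOf X B)ᵀ * colsOf X B)⁻¹ * (colsOf X B)ᵀ) *ᵥ Y) ⟨l, h⟩ else 0

/-- The preliminary estimate: least squares on the leading groups. -/
def prelim {n p : ℕ} {t : Fin p → ℕ} (ν l₁ : ℝ) (nrm : Idx t → ℝ)
    (X : Matrix (Fin n) (Idx t) ℝ) (Y : Fin n → ℝ) : Idx t → ℝ :=
  olsOn X Y (leaders (numLeaders p ν (tauStar (gram nrm X))) l₁ (groupNorm2 (corr nrm X Y)))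

open Classical in
/-- The GR-LOL estimator with thresholds `l₁`, `l₂`: block thresholding of the
preliminary estimate. -/
def grlol {n p : ℕ} {t : Fin p → ℕ} (ν l₁ l₂ : ℝ) (nrm : Idx t → ℝ)
    (X : Matrix (Fin n) (Idx t) ℝ) (Y : Fin n → ℝ) : Idx t → ℝ :=
  fun l => if l₂ / Real.sqrt (nrm l) ≤ groupNorm2 (prelim ν l₁ nrm X Y) l.1
    then prelim ν l₁ nrm X Y l else 0

/-! ### The constants -/

/-- `λ* = σ (M² v r* ∨ (t* ∨ log p)(1 + ν))^{1/2}`, where `L` is `t* ∨ log p`. -/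
def lamStar (σ M v r L ν : ℝ) : ℝ :=
  σ * Real.sqrt (max (M ^ 2 * v * r) (L * (1 + ν)))

/-- The constant `κ`. -/
def kap (ν : ℝ) : ℝ :=
  max (1 - ν)⁻¹ (max (4 * ((1 - ν) ^ 2)⁻¹) (2 * (2 * ν ^ 2 - ν + 3) * ((1 - ν) ^ 3)⁻¹))

/-- The constant `c_a`. -/
def cA (M q c₁ ν : ℝ) : ℝ := M ^ (-q) * max (9 / 4 * c₁ ^ 2) (3 * kap ν)

/-- The constant `c_b`. -/
def cB (c₁ c₂ ν : ℝ) : ℝ := min (c₁ ^ 2 / (64 * (1 + ν))) (c₂ ^ 2 / (192 * kap ν))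

/-- `1 ∧ r⁻¹` for `r ≥ 0`, with `0⁻¹ = ∞`. -/
def oneMinInv (r : ℝ) : ℝ := if r = 0 then 1 else min 1 r⁻¹

end

end GRLOL

namespace GRLOL

/-! ### Gaussian vectors -/

/-! Let `T` be the first threshold, `A j` the `l2`-norm of the normalised signal `α` on a group and
`V j` that of the correlated noise. The proof has a deterministic half and a probabilistic half.

Deterministic half: `R = α + (Γ - 1) α + noise`. A row of `Γ - 1` restricted to a group has
`l1`-norm at most `τ*`, and sparsity with `q ≤ 1` gives `‖α‖₁ ≤ M v^{1/2}`. The second term in the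
maximum defining `T` therefore bounds the bias in every group by `T / 2`, and `ρ j` differs from `A
j` by at most `T / 2 + V j`. With at most `N*` leaders, the restricted Gram matrix is within `ν < 1`
of the identity, so least squares is stable and costs `O(T² + V j²)` per leader. The second
thresholding adds `O(T²)` per leader, and a non-leader costs `A j²`. Leaders with weak signal and
non-leaders with strong signal can only be caused by large noise, which yields `loss_le`: the loss
is `O(1 / (a v))` times the sum over all groups of `min (A j) T ^ 2` and of `V j ^ 2` truncated to
`V j ≥ 9T/20`. The delicate case is a strong group discarded by the limit on the number of leaders
(`sum_nonleaders_le`).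

Probabilistic half: the signal sum is at most `T^{2-q} M^q v^{q/2}` by interpolation. Each truncated
noise term is exponentially small by a chi-square type moment bound (`integral_tailSq_le`), and the
restriction on `p`, or `log p ≤ t* ∨ log p` when `σ > 1`, absorbs the sum over groups
(`card_mul_tail_le`). Finally `T^{2-q} v^{q/2} / v = (T² / v)^{1-q/2}`, and `r* ≤ (τ*)²` bounds `T²
/ v` by the rate (`sq_threshold_le`).

The bound on the number of leaders needs the `ρ j` to be distinct, which holds almost surely
(`ae_groupNorm2_corr_ne`). -/

theorem pi_absolutelyContinuous : ∀ {n : ℕ} (μ ν : Fin n → Measure ℝ)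
    [∀ i, SigmaFinite (μ i)] [∀ i, SigmaFinite (ν i)], (∀ i, μ i ≪ ν i) →
    Measure.pi μ ≪ Measure.pi ν
  | 0, μ, ν, _, _, _ => by
    rw [Measure.pi_of_empty μ, Measure.pi_of_empty ν]
  | n + 1, μ, ν, _, _, h => by
    have e1 := (measurePreserving_piFinSuccAbove μ 0).symm
    have e2 := (measurePreserving_piFinSuccAbove ν 0).symm
    rw [← e1.map_eq, ← e2.map_eq]
    exact ((h 0).prod (pi_absolutelyContinuous _ _ fun j => h _)).map e1.measurable

theorem lintegral_pi_prod {ι : Type*} [Fintype ι] (μ : ι → Measure ℝ)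
    [∀ i, IsProbabilityMeasure (μ i)] (f : ι → ℝ → ℝ≥0∞) (hf : ∀ i, Measurable (f i)) :
    ∫⁻ w, ∏ i, f i (w i) ∂Measure.pi μ = ∏ i, ∫⁻ x, f i x ∂μ i := by
  rw [lintegral_prod_eq_prod_lintegral_of_indepFun Finset.univ (fun i (w : ι → ℝ) => f i (w i))
    (iIndepFun_pi fun i => (hf i).aemeasurable) fun i => (hf i).comp (measurable_pi_apply i)]
  refine Finset.prod_congr rfl fun i _ => ?_
  exact (measurePreserving_eval μ i).lintegral_comp (hf i)

theorem lintegral_exp_mul_gaussianReal (v : ℝ≥0) (a : ℝ) :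
    ∫⁻ x, ENNReal.ofReal (Real.exp (a * x)) ∂gaussianReal 0 v =
      ENNReal.ofReal (Real.exp (v * a ^ 2 / 2)) := by
  rw [← ofReal_integral_eq_lintegral_ofReal (integrable_exp_mul_gaussianReal a)
    (ae_of_all _ fun _ => (Real.exp_pos _).le)]
  have := congrFun (mgf_fun_id_gaussianReal (μ := 0) (v := v)) a
  simp only [mgf, zero_mul, zero_add] at this
  rw [this]

theorem lintegral_exp_linear_gaussian {ι : Type*} [Fintype ι] (v : ℝ≥0) (a : ι → ℝ) :
    ∫⁻ w, ENNReal.ofReal (Real.exp (∑ i, a i * w i)) ∂Measure.pi (fun _ : ι => gaussianReal 0 v) =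
      ENNReal.ofReal (Real.exp (v * (∑ i, a i ^ 2) / 2)) := by
  have h : ∀ w : ι → ℝ, ENNReal.ofReal (Real.exp (∑ i, a i * w i)) =
      ∏ i, ENNReal.ofReal (Real.exp (a i * w i)) := fun w => by
    rw [Real.exp_sum, ENNReal.ofReal_prod_of_nonneg fun _ _ => (Real.exp_pos _).le]
  simp_rw [h]
  rw [lintegral_pi_prod _ (fun i x => ENNReal.ofReal (Real.exp (a i * x)))
    (fun i => by fun_prop)]
  simp_rw [lintegral_exp_mul_gaussianReal]
  rw [← ENNReal.ofReal_prod_of_nonneg fun _ _ => (Real.exp_pos _).le, ← Real.exp_sum,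
    Finset.mul_sum, Finset.sum_div]

/-- The exponent `3 / 8` makes the moment `(1 - 2 · 3/8)^{-1/2}` exactly `2`, so that a group of
size `t` contributes the factor `2 ^ t`. -/
theorem lintegral_exp_sq_gaussianReal :
    ∫⁻ x, ENNReal.ofReal (Real.exp (3 / 8 * x ^ 2)) ∂gaussianReal 0 1 = 2 := by
  rw [gaussianReal_of_var_ne_zero 0 one_ne_zero,
    lintegral_withDensity_eq_lintegral_mul _ (measurable_gaussianPDF 0 1) (by fun_prop)]
  have h : ∀ x : ℝ, (gaussianPDF 0 1 * fun x => ENNReal.ofReal (Real.exp (3 / 8 * x ^ 2))) x =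
      ENNReal.ofReal ((√(2 * Real.pi))⁻¹ * Real.exp (-(1 / 8) * x ^ 2)) := fun x => by
    simp only [Pi.mul_apply, gaussianPDF, gaussianPDFReal]
    rw [← ENNReal.ofReal_mul (by positivity), mul_assoc, ← Real.exp_add]
    simp only [NNReal.coe_one, mul_one, sub_zero]
    congr 3
    ring
  simp_rw [h]
  rw [← ofReal_integral_eq_lintegral_ofReal
    ((integrable_exp_neg_mul_sq (by norm_num)).const_mul _) (ae_of_all _ fun _ => by positivity),
    integral_const_mul, integral_gaussian,
    show Real.pi / (1 / 8) = 2 ^ 2 * (2 * Real.pi) by ring, Real.sqrt_mul (by norm_num : (0:ℝ) ≤ 2 ^ 2),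
    Real.sqrt_sq (by norm_num), mul_comm (_⁻¹), mul_assoc,
    mul_inv_cancel₀ (by positivity)]
  simp

theorem lintegral_exp_sum_sq_gaussian {ι : Type*} [Fintype ι] :
    ∫⁻ g, ENNReal.ofReal (Real.exp (3 / 8 * ∑ s, g s ^ 2))
      ∂Measure.pi (fun _ : ι => gaussianReal 0 1) = 2 ^ Fintype.card ι := by
  have h : ∀ w : ι → ℝ, ENNReal.ofReal (Real.exp (3 / 8 * ∑ i, w i ^ 2)) =
      ∏ i, ENNReal.ofReal (Real.exp (3 / 8 * w i ^ 2)) := fun w => by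
    rw [Finset.mul_sum, Real.exp_sum, ENNReal.ofReal_prod_of_nonneg fun _ _ => (Real.exp_pos _).le]
  simp_rw [h]
  rw [lintegral_pi_prod _ (fun i x => ENNReal.ofReal (Real.exp (3 / 8 * x ^ 2)))
    (fun i => by fun_prop)]
  simp [lintegral_exp_sq_gaussianReal]

/-- The squared norm of a linear image `Aᵀ W` of a Gaussian white noise is dominated, in the sense
of exponential moments, by the largest eigenvalue of `Aᵀ A` times a chi-square variable. -/
theorem lintegral_exp_sq_norm_le {n : ℕ} {ι : Type*} [Fintype ι] (A : Fin n → ι → ℝ)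
    (v : ℝ≥0) (hv : v ≠ 0) (K : ℝ) (hK : 0 < K)
    (hA : ∀ g : ι → ℝ, ∑ i, (∑ s, A i s * g s) ^ 2 ≤ K * ∑ s, g s ^ 2) :
    ∫⁻ w, ENNReal.ofReal (Real.exp (3 / 8 * ((∑ s, (∑ i, w i * A i s) ^ 2) / (v * K))))
      ∂Measure.pi (fun _ : Fin n => gaussianReal 0 v) ≤ 2 ^ Fintype.card ι := by
  have hv' : (0 : ℝ) < v := by positivity
  -- Linearisation: the exponential of a square is the Laplace transform of an auxiliary standard
  -- Gaussian `g`. After exchanging the integrals, `w` is integrated first, and `hA` controls the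
  -- resulting `‖A g‖²`.
  set c : ℝ := 3 / (4 * (v * K)) with hc
  have hc0 : 0 ≤ c := by positivity
  have key : ∀ w : Fin n → ℝ,
      ENNReal.ofReal (Real.exp (3 / 8 * ((∑ s, (∑ i, w i * A i s) ^ 2) / (v * K)))) =
      ∫⁻ g, ENNReal.ofReal (Real.exp (∑ s, (√c * ∑ i, w i * A i s) * g s))
        ∂Measure.pi (fun _ : ι => gaussianReal 0 1) := fun w => by
    rw [lintegral_exp_linear_gaussian]
    simp_rw [mul_pow, Real.sq_sqrt hc0, ← Finset.mul_sum]
    congr 2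
    simp only [NNReal.coe_one, one_mul, hc]
    field_simp
    ring
  simp_rw [key]
  rw [lintegral_lintegral_swap (by
    apply Measurable.aemeasurable
    simp only [Function.uncurry_def]
    fun_prop)]
  rw [← lintegral_exp_sum_sq_gaussian (ι := ι)]
  refine lintegral_mono fun g => ?_
  have h2 : ∀ w : Fin n → ℝ, ∑ s, (√c * ∑ i, w i * A i s) * g s =
      ∑ i, (√c * ∑ s, A i s * g s) * w i := fun w => by
    simp_rw [Finset.mul_sum, Finset.sum_mul]
    rw [Finset.sum_comm]
    refine Finset.sum_congr rfl fun i _ => Finset.sum_congr rfl fun s _ => by ring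
  simp_rw [h2]
  rw [lintegral_exp_linear_gaussian]
  refine ENNReal.ofReal_le_ofReal (Real.exp_le_exp.2 ?_)
  simp_rw [mul_pow, Real.sq_sqrt hc0, ← Finset.mul_sum]
  calc (v : ℝ) * (c * ∑ i, (∑ s, A i s * g s) ^ 2) / 2
      ≤ v * (c * (K * ∑ s, g s ^ 2)) / 2 := by gcongr; exact hA g
    _ = 3 / 8 * ∑ s, g s ^ 2 := by rw [hc]; field_simp; ring

/-- Truncated second moment of the norm of a linear image of a Gaussian white noise. -/
theorem lintegral_tail_sq_norm_le {n : ℕ} {ι : Type*} [Fintype ι] (A : Fin n → ι → ℝ)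
    (v : ℝ≥0) (hv : v ≠ 0) (K : ℝ) (hK : 0 < K)
    (hA : ∀ g : ι → ℝ, ∑ i, (∑ s, A i s * g s) ^ 2 ≤ K * ∑ s, g s ^ 2) (y : ℝ) :
    ∫⁻ w, ENNReal.ofReal (if y ≤ ∑ s, (∑ i, w i * A i s) ^ 2 then ∑ s, (∑ i, w i * A i s) ^ 2
        else 0) ∂Measure.pi (fun _ : Fin n => gaussianReal 0 v) ≤
      ENNReal.ofReal (200 / 3 * (v * K) * Real.exp (-(9 / 25) * (y / (v * K))) *
        2 ^ Fintype.card ι) := by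
  have hv' : (0 : ℝ) < v := by positivity
  have hS : 0 < v * K := by positivity
  set D := 200 / 3 * (v * K) * Real.exp (-(9 / 25) * (y / (v * K))) with hD
  have hD0 : 0 ≤ D := by positivity
  -- The exponent is split as `3/8 = 9/25 + 3/200`: the first part pays for the cutoff at `y`, the
  -- second for the linear factor `Q`.
  have pt : ∀ Q : ℝ, (if y ≤ Q then Q else 0) ≤ D * Real.exp (3 / 8 * (Q / (v * K))) := by
    intro Q
    split_ifs with h
    · have h1 : Q / (v * K) ≤ 200 / 3 * Real.exp (3 / 200 * (Q / (v * K))) := by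
        have := Real.add_one_le_exp (3 / 200 * (Q / (v * K)))
        linarith
      have h2 : Real.exp (3 / 200 * (Q / (v * K))) ≤
          Real.exp (-(9 / 25) * (y / (v * K))) * Real.exp (3 / 8 * (Q / (v * K))) := by
        rw [← Real.exp_add]
        apply Real.exp_le_exp.2
        have : y / (v * K) ≤ Q / (v * K) := by gcongr
        linarith
      calc Q = (v * K) * (Q / (v * K)) := by field_simp
        _ ≤ (v * K) * (200 / 3 * (Real.exp (-(9 / 25) * (y / (v * K))) *
            Real.exp (3 / 8 * (Q / (v * K))))) := by gcongr; linarith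
        _ = _ := by rw [hD]; ring
    · positivity
  calc _ ≤ ∫⁻ w, ENNReal.ofReal D *
        ENNReal.ofReal (Real.exp (3 / 8 * ((∑ s, (∑ i, w i * A i s) ^ 2) / (v * K))))
        ∂Measure.pi (fun _ : Fin n => gaussianReal 0 v) := by
        refine lintegral_mono fun w => ?_
        rw [← ENNReal.ofReal_mul hD0]
        exact ENNReal.ofReal_le_ofReal (pt _)
    _ ≤ ENNReal.ofReal D * 2 ^ Fintype.card ι := by
        rw [lintegral_const_mul _ (by fun_prop)]
        gcongr
        exact lintegral_exp_sq_norm_le A v hv K hK hA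
    _ = _ := by
        rw [ENNReal.ofReal_mul hD0, ENNReal.ofReal_pow (by norm_num)]
        simp

/-- A quadratic polynomial function whose leading part does not vanish in some direction is almost
surely nonzero under a Gaussian white noise. -/
theorem ae_ne_zero_of_quadratic {n : ℕ} (v : ℝ≥0) (hv : v ≠ 0) (f : (Fin n → ℝ) → ℝ)
    (hf : Measurable f) (u : Fin n → ℝ) (c : ℝ) (hc : c ≠ 0)
    (h : ∀ w, ∃ b d : ℝ, ∀ s : ℝ, f (w + s • u) = c * s ^ 2 + b * s + d) :
    ∀ᵐ w ∂Measure.pi (fun _ : Fin n => gaussianReal 0 v), f w ≠ 0 := by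
  have hac : Measure.pi (fun _ : Fin n => gaussianReal 0 v) ≪
      (volume : Measure (Fin n → ℝ)) :=
    pi_absolutelyContinuous _ _ fun _ => gaussianReal_absolutelyContinuous 0 hv
  refine hac.ae_le ?_
  -- Fubini along `u`: it suffices that almost every point of each line directed by `u` lies in the
  -- set, and there `f` is a polynomial of degree two with finitely many zeros.
  refine ae_mem_of_ae_add_linearMap_mem (s := {w | f w ≠ 0}) (LinearMap.toSpanSingleton ℝ _ u)
    (volume : Measure ℝ) volume (measurableSet_eq_fun hf measurable_const).compl fun w => ?_
  obtain ⟨b, d, hbd⟩ := h w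
  simp only [LinearMap.toSpanSingleton_apply, Set.mem_ofPred_eq, hbd]
  set P : Polynomial ℝ := Polynomial.C c * Polynomial.X ^ 2 + Polynomial.C b * Polynomial.X +
    Polynomial.C d with hP
  have hP0 : P ≠ 0 := fun h0 => by
    have h2 : P.coeff 2 = c := by simp [hP]
    exact hc (by rw [← h2, h0, Polynomial.coeff_zero])
  have hfin := (P.rootSet_finite ℝ).measure_zero (volume : Measure ℝ)
  rw [ae_iff]
  refine measure_mono_null (fun s hs => ?_) hfin
  simp only [ne_eq, not_not, Set.mem_ofPred_eq] at hs
  rw [Polynomial.mem_rootSet]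
  exact ⟨hP0, by simpa [hP] using hs⟩

/-! ### Selection of the leading groups -/

open Classical in
theorem mem_leaders {p N : ℕ} {l : ℝ} {ρ : Fin p → ℝ} (hl : 0 ≤ l) (hρ : ∀ j, 0 ≤ ρ j)
    (j : Fin p) : j ∈ leaders N l ρ ↔
      l ≤ ρ j ∧ (Finset.univ.filter fun i => ρ j < ρ i).card < N := by
  simp only [leaders, Finset.mem_filter, Finset.mem_univ, true_and,
    pow_le_pow_iff_left₀ hl (hρ _) two_ne_zero, pow_lt_pow_iff_left₀ (hρ _) (hρ _) two_ne_zero]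

/-- Without ties, all other leaders lie strictly above the weakest leader, and fewer than `N` groups
do. Ties at the `N`-th value could produce more than `N` leaders. -/
theorem card_leaders_le {p N : ℕ} {l : ℝ} {ρ : Fin p → ℝ}
    (hinj : ∀ i j, i ≠ j → ρ i ^ 2 ≠ ρ j ^ 2) : (leaders N l ρ).card ≤ N := by
  classical
  rcases (leaders N l ρ).eq_empty_or_nonempty with h | h
  · simp [h]
  obtain ⟨j, hj, hmin⟩ := Finset.exists_min_image _ (fun j => ρ j ^ 2) h
  have hj2 : (Finset.univ.filter fun i => ρ j ^ 2 < ρ i ^ 2).card < N := by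
    have := hj
    simp only [leaders, Finset.mem_filter] at this
    convert this.2.2
  have hsub : (leaders N l ρ).erase j ⊆ Finset.univ.filter fun i => ρ j ^ 2 < ρ i ^ 2 := by
    intro i hi
    rw [Finset.mem_erase] at hi
    simp only [Finset.mem_filter, Finset.mem_univ, true_and]
    exact lt_of_le_of_ne (hmin i hi.2) (hinj _ _ hi.1.symm)
  have := Finset.card_le_card hsub
  rw [Finset.card_erase_of_mem hj] at this
  omega

/-- The truncation at level `x` of the square of `y`. -/
noncomputable def tailSq (x y : ℝ) : ℝ := if x ^ 2 ≤ y ^ 2 then y ^ 2 else 0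

theorem tailSq_nonneg (x y : ℝ) : 0 ≤ tailSq x y := by
  unfold tailSq; split_ifs <;> positivity

theorem tailSq_of_le {x y : ℝ} (hx : 0 ≤ x) (h : x ≤ y) : tailSq x y = y ^ 2 :=
  if_pos (pow_le_pow_left₀ hx h 2)

/-- A group passing the threshold with noise below `9T/20` has signal at least `T - T/2 - 9T/20 =
T/20`; otherwise the truncated noise term is active. Either way the cost of a leader is paid. -/
theorem leader_cost_le {T A V r : ℝ} (hT : 0 ≤ T) (hV : 0 ≤ V) (hr : T ≤ r)
    (h : r ≤ A + T / 2 + V) :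
    T ^ 2 + V ^ 2 ≤ 800 * (min A T ^ 2 + tailSq (9 / 20 * T) V) := by
  rcases le_or_gt (9 / 20 * T) V with hV' | hV'
  · rw [tailSq_of_le (by positivity) hV']
    nlinarith [sq_nonneg (min A T)]
  · have hm : T / 20 ≤ min A T := le_min (by linarith) (by linarith)
    nlinarith [tailSq_nonneg (9 / 20 * T) V, hV]

/-- The total size of the groups that are not selected. -/
theorem sum_nonleaders_le {p : ℕ} (N : ℕ) {T H : ℝ} (A V ρ : Fin p → ℝ) (hT : 0 < T)
    (hA : ∀ j, 0 ≤ A j) (hρ : ∀ j, 0 ≤ ρ j)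
    (h1 : ∀ j, ρ j ≤ A j + T / 2 + V j) (h2 : ∀ j, A j ≤ ρ j + T / 2 + V j)
    (hH : ∑ j, A j ≤ H) (hN : N = p ∨ H ≤ N * T) :
    ∑ j ∈ Finset.univ.filter (fun j => j ∉ leaders N T ρ), A j ^ 2 ≤
      101 * (∑ j, min (A j) T ^ 2 + ∑ j, tailSq (9 / 20 * T) (V j)) := by
  classical
  set Z : Fin p → ℝ := fun j => tailSq (9 / 20 * T) (V j) with hZ
  have hZ0 : ∀ j, 0 ≤ Z j := fun j => tailSq_nonneg _ _
  -- The groups whose signal dominates both `T` and their own noise: they pass the threshold, so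
  -- only the limit `N` can have excluded them. Every other non-leader pays for itself, through `A j
  -- ≤ 10 T` or `A j ≤ 10 V j`.
  set J : Finset (Fin p) := Finset.univ.filter fun j =>
    j ∉ leaders N T ρ ∧ 10 * T < A j ∧ 10 * V j < A j with hJ
  have hlarge : ∀ j, T ≤ ρ j → j ∉ leaders N T ρ →
      N ≤ (Finset.univ.filter fun i => ρ j < ρ i).card := fun j hj hn => by
    rw [mem_leaders hT.le hρ] at hn
    push Not at hn
    convert hn hj
  have hJρ : ∀ j ∈ J, 17 / 20 * A j ≤ ρ j ∧ 10 * T < A j ∧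
      N ≤ (Finset.univ.filter fun i => ρ j < ρ i).card := fun j hj => by
    simp only [hJ, Finset.mem_filter, Finset.mem_univ, true_and] at hj
    have h3 : 17 / 20 * A j ≤ ρ j := by linarith [h2 j, hj.2.1, hj.2.2]
    exact ⟨h3, hj.2.1, hlarge j (by linarith [hj.2.1]) hj.1⟩
  have hsplit : ∀ j ∈ Finset.univ.filter (fun j => j ∉ leaders N T ρ),
      A j ^ 2 ≤ 100 * (min (A j) T ^ 2 + Z j) + if j ∈ J then A j ^ 2 else 0 := by
    intro j hj
    have hj' : j ∉ leaders N T ρ := (Finset.mem_filter.1 hj).2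
    by_cases hjJ : j ∈ J
    · rw [if_pos hjJ]
      nlinarith [hZ0 j, sq_nonneg (min (A j) T)]
    · rw [if_neg hjJ, add_zero]
      have hjJ' : 10 * T < A j → A j ≤ 10 * V j := fun h => by
        by_contra! h'
        exact hjJ (by simp [hJ, hj', h, h'])
      rcases le_or_gt (A j) (10 * T) with hle | hlt
      · have hm : A j / 10 ≤ min (A j) T := le_min (by linarith [hA j]) (by linarith)
        nlinarith [hZ0 j, hA j]
      · have h4 := hjJ' hlt
        have : Z j = V j ^ 2 := tailSq_of_le (by positivity) (by linarith)
        rw [this]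
        nlinarith [hA j, sq_nonneg (min (A j) T)]
  have hJsum : ∑ j ∈ J, A j ^ 2 ≤ ∑ j, Z j := by
    rcases J.eq_empty_or_nonempty with hJe | ⟨j₀, hj₀⟩
    · rw [hJe, Finset.sum_empty]
      exact Finset.sum_nonneg fun j _ => hZ0 j
    -- When `N = p`, no group can be excluded by the ranking, since it does not beat itself; so `J`
    -- would be empty.
    have hHN : H ≤ N * T := by
      rcases hN with hN | hN
      · have h5 := (hJρ j₀ hj₀).2.2
        have h6 : (Finset.univ.filter fun i => ρ j₀ < ρ i).card < p := by
          have h9 : (Finset.univ.filter fun i => ρ j₀ < ρ i) ⊂ Finset.univ :=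
            Finset.filter_ssubset.2 ⟨j₀, Finset.mem_univ _, lt_irrefl _⟩
          simpa using Finset.card_lt_card h9
        omega
      · exact hN
    have hcount : ∀ (S : Finset (Fin p)) (x : ℝ), (∀ j ∈ S, x * T ≤ A j) → S.card * x ≤ N := by
      intro S x hS
      have h7 : (S.card : ℝ) * (x * T) ≤ ∑ j, A j := by
        calc (S.card : ℝ) * (x * T) = ∑ _j ∈ S, x * T := by simp
          _ ≤ ∑ j ∈ S, A j := Finset.sum_le_sum hS
          _ ≤ ∑ j, A j := Finset.sum_le_sum_of_subset_of_nonneg (Finset.subset_univ _)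
            fun j _ _ => hA j
      have : (S.card * x) * T ≤ N * T := by linarith
      exact le_of_mul_le_mul_right this hT
    have hJcard := hcount J 10 fun j hj => (hJρ j hj).2.1.le
    have hNpos : (0 : ℝ) < N := by
      have : (1 : ℝ) ≤ J.card := by exact_mod_cast Finset.card_pos.2 ⟨j₀, hj₀⟩
      linarith
    -- At least `N` groups beat `j`, and at most `N / 4` of them have signal `4T` or more. Each of
    -- the remaining `3N/4` owes its rank to noise: `V i ≥ 17/20 A j - 4T - T/2 ≥ 2/5 A j`. As `3/4
    -- · (2/5)² ≥ 1/10`, these noises pay for `N A j ^ 2 / 10`; and `J` has at most `N / 10`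
    -- elements.
    have hbound : ∀ j ∈ J, N * A j ^ 2 ≤ 10 * ∑ i, Z i := by
      intro j hj
      obtain ⟨hρj, hTj, hcard⟩ := hJρ j hj
      set S := Finset.univ.filter fun i => ρ j < ρ i with hS
      set B := Finset.univ.filter fun i => 4 * T ≤ A i with hB
      have hBc := hcount B 4 fun i hi => (Finset.mem_filter.1 hi).2
      have hSB : (S.card : ℝ) - B.card ≤ (S \ B).card := by
        have := Finset.le_card_sdiff B S
        have h8 : S.card ≤ (S \ B).card + B.card := by omega
        have : (S.card : ℝ) ≤ (S \ B).card + B.card := by exact_mod_cast h8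
        linarith
      have hcard' : (N : ℝ) ≤ S.card := by exact_mod_cast hcard
      have hZi : ∀ i ∈ S \ B, (2 / 5 * A j) ^ 2 ≤ Z i := by
        intro i hi
        rw [Finset.mem_sdiff] at hi
        have hi1 : ρ j < ρ i := (Finset.mem_filter.1 hi.1).2
        have hi2 : A i < 4 * T := by
          by_contra! h
          exact hi.2 (by simp [hB, h])
        have hVi : 2 / 5 * A j ≤ V i := by linarith [h1 i]
        have : Z i = V i ^ 2 := tailSq_of_le (by positivity) (by linarith)
        rw [this]
        exact pow_le_pow_left₀ (by linarith [hA j]) hVi 2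
      have hsum : ((S \ B).card : ℝ) * (2 / 5 * A j) ^ 2 ≤ ∑ i, Z i := by
        calc ((S \ B).card : ℝ) * (2 / 5 * A j) ^ 2 = ∑ _i ∈ S \ B, (2 / 5 * A j) ^ 2 := by simp
          _ ≤ ∑ i ∈ S \ B, Z i := Finset.sum_le_sum hZi
          _ ≤ ∑ i, Z i := Finset.sum_le_sum_of_subset_of_nonneg (Finset.subset_univ _)
            fun j _ _ => hZ0 j
      have hc : 3 / 4 * (N : ℝ) ≤ (S \ B).card := by linarith
      have : 3 / 4 * (N : ℝ) * (2 / 5 * A j) ^ 2 ≤ ∑ i, Z i :=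
        (mul_le_mul_of_nonneg_right hc (sq_nonneg _)).trans hsum
      nlinarith [Finset.sum_nonneg fun i (_ : i ∈ Finset.univ) => hZ0 i]
    have hfin : N * ∑ j ∈ J, A j ^ 2 ≤ N * ∑ i, Z i := by
      calc N * ∑ j ∈ J, A j ^ 2 = ∑ j ∈ J, N * A j ^ 2 := Finset.mul_sum _ _ _
        _ ≤ ∑ _j ∈ J, 10 * ∑ i, Z i := Finset.sum_le_sum hbound
        _ = J.card * 10 * ∑ i, Z i := by simp; ring
        _ ≤ N * ∑ i, Z i :=
          mul_le_mul_of_nonneg_right hJcard (Finset.sum_nonneg fun i _ => hZ0 i)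
    exact le_of_mul_le_mul_left hfin hNpos
  have hm0 : ∀ j, 0 ≤ 100 * (min (A j) T ^ 2 + Z j) := fun j => by
    have := hZ0 j
    positivity
  calc _ ≤ ∑ j ∈ Finset.univ.filter (fun j => j ∉ leaders N T ρ),
        (100 * (min (A j) T ^ 2 + Z j) + if j ∈ J then A j ^ 2 else 0) := Finset.sum_le_sum hsplit
    _ ≤ ∑ j, (100 * (min (A j) T ^ 2 + Z j) + if j ∈ J then A j ^ 2 else 0) :=
        Finset.sum_le_sum_of_subset_of_nonneg (Finset.filter_subset _ _) fun j _ _ => by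
          have := hm0 j
          split_ifs <;> positivity
    _ = 100 * (∑ j, min (A j) T ^ 2 + ∑ j, Z j) + ∑ j ∈ J, A j ^ 2 := by
        rw [Finset.sum_add_distrib, ← Finset.mul_sum, Finset.sum_add_distrib]
        simp
    _ ≤ _ := by
        have : 0 ≤ ∑ j, min (A j) T ^ 2 := Finset.sum_nonneg fun j _ => sq_nonneg _
        linarith

/-! ### Group norms and the Gram matrix -/

section Gram

variable {n p : ℕ} {t : Fin p → ℕ}

theorem groupNorm2_nonneg (u : Idx t → ℝ) (j : Fin p) : 0 ≤ groupNorm2 u j := Real.sqrt_nonneg _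

theorem groupNorm1_nonneg (u : Idx t → ℝ) (j : Fin p) : 0 ≤ groupNorm1 u j :=
  Finset.sum_nonneg fun _ _ => abs_nonneg _

theorem groupNorm2_sq (u : Idx t → ℝ) (j : Fin p) :
    groupNorm2 u j ^ 2 = ∑ s, u ⟨j, s⟩ ^ 2 :=
  Real.sq_sqrt (Finset.sum_nonneg fun _ _ => sq_nonneg _)

theorem groupNorm2_add_le (u w : Idx t → ℝ) (j : Fin p) :
    groupNorm2 (fun l => u l + w l) j ≤ groupNorm2 u j + groupNorm2 w j := by
  have h : ∀ u : Idx t → ℝ, groupNorm2 u j = ‖WithLp.toLp 2 fun s => u ⟨j, s⟩‖ := fun u => by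
    simp [EuclideanSpace.norm_eq, groupNorm2]
  rw [h, h, h]
  exact norm_add_le (WithLp.toLp 2 fun s => u ⟨j, s⟩) (WithLp.toLp 2 fun s => w ⟨j, s⟩)

theorem groupNorm2_neg (u : Idx t → ℝ) (j : Fin p) :
    groupNorm2 (fun l => -u l) j = groupNorm2 u j := by
  simp [groupNorm2]

theorem groupNorm2_le_groupNorm1 (u : Idx t → ℝ) (j : Fin p) :
    groupNorm2 u j ≤ groupNorm1 u j := by
  refine Real.sqrt_le_iff.2 ⟨groupNorm1_nonneg u j, ?_⟩
  simp_rw [← sq_abs (u _)]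
  exact Finset.sum_sq_le_sq_sum_of_nonneg fun _ _ => abs_nonneg _

theorem gammaBT_nonneg (Γ : Matrix (Idx t) (Idx t) ℝ) : 0 ≤ gammaBT Γ := NNReal.coe_nonneg _

theorem gammaBG_nonneg (Γ : Matrix (Idx t) (Idx t) ℝ) : 0 ≤ gammaBG Γ := NNReal.coe_nonneg _

theorem tauStar_nonneg (Γ : Matrix (Idx t) (Idx t) ℝ) : 0 ≤ tauStar Γ :=
  add_nonneg (mul_nonneg (Nat.cast_nonneg _) (gammaBT_nonneg Γ)) (gammaBG_nonneg Γ)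

theorem abs_le_gammaBT (Γ : Matrix (Idx t) (Idx t) ℝ) {l l' : Idx t} (h : (l.2 : ℕ) ≠ l'.2) :
    |Γ l l'| ≤ gammaBT Γ := by
  rw [← Real.norm_eq_abs, ← coe_nnnorm]
  exact NNReal.coe_le_coe.2 (Finset.le_sup (f := fun x : Idx t × Idx t => ‖Γ x.1 x.2‖₊)
    (b := (l, l')) (by simpa using h))

theorem abs_le_gammaBG (Γ : Matrix (Idx t) (Idx t) ℝ) {l l' : Idx t} (h : l.1 ≠ l'.1)
    (h' : (l.2 : ℕ) = l'.2) : |Γ l l'| ≤ gammaBG Γ := by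
  rw [← Real.norm_eq_abs, ← coe_nnnorm]
  exact NNReal.coe_le_coe.2 (Finset.le_sup (f := fun x : Idx t × Idx t => ‖Γ x.1 x.2‖₊)
    (b := (l, l')) (by simpa using ⟨h, h'⟩))

/-- A row of the off-diagonal part of `Γ`, restricted to a group, has `l1`-norm at most `τ*`. -/
theorem sum_abs_offDiag_le (Γ : Matrix (Idx t) (Idx t) ℝ) (hΓ : ∀ l, Γ l l = 1) (l : Idx t)
    (j : Fin p) : ∑ s, |(Γ - 1) l ⟨j, s⟩| ≤ tauStar Γ := by
  -- At most one element of a group shares the rank of `l`; it is either `l` itself, where `Γ - 1`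
  -- vanishes, or in another group. Hence `γ_BG` is counted only once.
  have hterm : ∀ s : Fin (t j), |(Γ - 1) l ⟨j, s⟩| ≤
      gammaBT Γ + if (s : ℕ) = l.2 then gammaBG Γ else 0 := by
    intro s
    by_cases hl : l = ⟨j, s⟩
    · rw [← hl, Matrix.sub_apply, hΓ, Matrix.one_apply_eq, sub_self, abs_zero]
      have := gammaBT_nonneg Γ
      have := gammaBG_nonneg Γ
      split_ifs <;> positivity
    · rw [Matrix.sub_apply, Matrix.one_apply_ne hl, sub_zero]
      split_ifs with hs
      · have hj : l.1 ≠ j := by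
          rintro rfl
          exact hl (Sigma.ext rfl (heq_of_eq (Fin.ext hs.symm)))
        exact (abs_le_gammaBG Γ (l' := ⟨j, s⟩) hj hs.symm).trans
          (le_add_of_nonneg_left (gammaBT_nonneg Γ))
      · rw [add_zero]
        exact abs_le_gammaBT Γ (l' := ⟨j, s⟩) fun h => hs h.symm
  have hind : ∑ s : Fin (t j), (if (s : ℕ) = l.2 then gammaBG Γ else 0) ≤ gammaBG Γ := by
    by_cases h : (l.2 : ℕ) < t j
    · have : ∀ s : Fin (t j), ((s : ℕ) = l.2) ↔ s = ⟨l.2, h⟩ := fun s => by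
        rw [Fin.ext_iff]
      simp [this]
    · rw [Finset.sum_eq_zero]
      · exact gammaBG_nonneg Γ
      · intro s _
        rw [if_neg]
        have := s.2
        omega
  calc ∑ s, |(Γ - 1) l ⟨j, s⟩|
      ≤ ∑ s : Fin (t j), (gammaBT Γ + if (s : ℕ) = l.2 then gammaBG Γ else 0) :=
        Finset.sum_le_sum fun s _ => hterm s
    _ ≤ t j * gammaBT Γ + gammaBG Γ := by
        rw [Finset.sum_add_distrib]
        simpa using hind
    _ ≤ tauStar Γ := by
        have : (t j : ℝ) ≤ tStar t := by exact_mod_cast Finset.le_sup (f := t) (Finset.mem_univ j)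
        exact add_le_add_left (mul_le_mul_of_nonneg_right this (gammaBT_nonneg Γ)) _

theorem gram_apply (nrm : Idx t → ℝ) (X : Matrix (Fin n) (Idx t) ℝ) (l l' : Idx t) :
    gram nrm X l l' = ∑ i, normDesign nrm X i l * normDesign nrm X i l' := rfl

theorem gram_comm (nrm : Idx t → ℝ) (X : Matrix (Fin n) (Idx t) ℝ) (l l' : Idx t) :
    gram nrm X l l' = gram nrm X l' l := by
  simp_rw [gram_apply, mul_comm]

/-- Schur's test for the quadratic form of a symmetric matrix. -/
theorem abs_sum_sum_le_of_rowSum_le {ι : Type*} (A : ι → ι → ℝ) (hA : ∀ l l', A l l' = A l' l)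
    (S : Finset ι) (K : ℝ) (hK : ∀ l ∈ S, ∑ l' ∈ S, |A l l'| ≤ K) (e : ι → ℝ) :
    |∑ l ∈ S, ∑ l' ∈ S, e l * A l l' * e l'| ≤ K * ∑ l ∈ S, e l ^ 2 := by
  have h1 : ∑ l ∈ S, ∑ l' ∈ S, |A l l'| * e l ^ 2 ≤ K * ∑ l ∈ S, e l ^ 2 := by
    rw [Finset.mul_sum]
    refine Finset.sum_le_sum fun l hl => ?_
    rw [← Finset.sum_mul]
    exact mul_le_mul_of_nonneg_right (hK l hl) (sq_nonneg _)
  have h2 : ∑ l ∈ S, ∑ l' ∈ S, |A l l'| * e l' ^ 2 = ∑ l ∈ S, ∑ l' ∈ S, |A l l'| * e l ^ 2 := by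
    rw [Finset.sum_comm]
    simp_rw [hA]
  calc |∑ l ∈ S, ∑ l' ∈ S, e l * A l l' * e l'|
      ≤ ∑ l ∈ S, ∑ l' ∈ S, |e l * A l l' * e l'| :=
        (Finset.abs_sum_le_sum_abs _ _).trans
          (Finset.sum_le_sum fun l _ => Finset.abs_sum_le_sum_abs _ _)
    _ ≤ ∑ l ∈ S, ∑ l' ∈ S, (|A l l'| * e l ^ 2 / 2 + |A l l'| * e l' ^ 2 / 2) := by
        refine Finset.sum_le_sum fun l _ => Finset.sum_le_sum fun l' _ => ?_
        rw [abs_mul, abs_mul]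
        have := two_mul_le_add_sq |e l| |e l'|
        rw [sq_abs, sq_abs] at this
        nlinarith [abs_nonneg (A l l')]
    _ = ∑ l ∈ S, ∑ l' ∈ S, |A l l'| * e l ^ 2 := by
        simp_rw [Finset.sum_add_distrib, ← Finset.sum_div]
        rw [h2]
        ring
    _ ≤ _ := h1

/-- The regressors of the groups of `B`. -/
def idxOf (t : Fin p → ℕ) (B : Finset (Fin p)) : Finset (Idx t) := B.sigma fun _ => Finset.univ

theorem mem_idxOf {B : Finset (Fin p)} {l : Idx t} : l ∈ idxOf t B ↔ l.1 ∈ B := by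
  simp [idxOf]

theorem sum_idxOf (B : Finset (Fin p)) (f : Idx t → ℝ) :
    ∑ l ∈ idxOf t B, f l = ∑ j ∈ B, ∑ s, f ⟨j, s⟩ := Finset.sum_sigma _ _ _

/-- Few groups are almost orthogonal. -/
theorem abs_quadForm_sub_le (Γ : Matrix (Idx t) (Idx t) ℝ) (hΓ : ∀ l, Γ l l = 1)
    (hs : ∀ l l', Γ l l' = Γ l' l) (B : Finset (Fin p)) (e : Idx t → ℝ) :
    |∑ l ∈ idxOf t B, ∑ l' ∈ idxOf t B, e l * Γ l l' * e l' - ∑ l ∈ idxOf t B, e l ^ 2| ≤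
      B.card * tauStar Γ * ∑ l ∈ idxOf t B, e l ^ 2 := by
  have h : ∑ l ∈ idxOf t B, ∑ l' ∈ idxOf t B, e l * Γ l l' * e l' - ∑ l ∈ idxOf t B, e l ^ 2 =
      ∑ l ∈ idxOf t B, ∑ l' ∈ idxOf t B, e l * (Γ - 1) l l' * e l' := by
    rw [← Finset.sum_sub_distrib]
    refine Finset.sum_congr rfl fun l hl => ?_
    simp_rw [Matrix.sub_apply, mul_sub, sub_mul, Finset.sum_sub_distrib, Matrix.one_apply]
    simp [hl, sq]
  rw [h]
  refine abs_sum_sum_le_of_rowSum_le _ (fun l l' => ?_) _ _ (fun l _ => ?_) e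
  · rw [Matrix.sub_apply, Matrix.sub_apply, hs, Matrix.one_apply, Matrix.one_apply]
    simp [eq_comm]
  · rw [sum_idxOf]
    calc _ ≤ ∑ _j ∈ B, tauStar Γ := Finset.sum_le_sum fun j _ => sum_abs_offDiag_le Γ hΓ l j
      _ = _ := by simp

/-- Stability of the normal equations on few groups. -/
theorem sum_sq_le_of_normalEq (Γ : Matrix (Idx t) (Idx t) ℝ) (hΓ : ∀ l, Γ l l = 1)
    (hs : ∀ l l', Γ l l' = Γ l' l) (B : Finset (Fin p)) {ν : ℝ} (hν : ν < 1)
    (hB : B.card * tauStar Γ ≤ ν) (e h : Idx t → ℝ)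
    (heq : ∀ l ∈ idxOf t B, ∑ l' ∈ idxOf t B, Γ l l' * e l' = h l) :
    ∑ l ∈ idxOf t B, e l ^ 2 ≤ ((1 - ν) ^ 2)⁻¹ * ∑ l ∈ idxOf t B, h l ^ 2 := by
  set E := ∑ l ∈ idxOf t B, e l ^ 2 with hE
  have hE0 : 0 ≤ E := Finset.sum_nonneg fun _ _ => sq_nonneg _
  -- The quadratic form at `e` is at least `(1 - ν) E`; by the equation it equals the pairing of `e`
  -- with `h`, and Cauchy–Schwarz concludes.
  have h1 := (abs_le.1 (abs_quadForm_sub_le Γ hΓ hs B e)).1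
  have h2 : ∑ l ∈ idxOf t B, ∑ l' ∈ idxOf t B, e l * Γ l l' * e l' =
      ∑ l ∈ idxOf t B, e l * h l := by
    refine Finset.sum_congr rfl fun l hl => ?_
    rw [← heq l hl, Finset.mul_sum]
    simp_rw [mul_assoc]
  rw [h2] at h1
  have h3 : (1 - ν) * E ≤ ∑ l ∈ idxOf t B, e l * h l := by nlinarith
  have h4 := Finset.sum_mul_sq_le_sq_mul_sq (idxOf t B) e h
  have h5 : ((1 - ν) * E) ^ 2 ≤ E * ∑ l ∈ idxOf t B, h l ^ 2 :=
    (pow_le_pow_left₀ (mul_nonneg (by linarith) hE0) h3 2).trans h4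
  have h6 : 0 < (1 - ν) ^ 2 := by have : 0 < 1 - ν := by linarith
                                  positivity
  rw [inv_mul_eq_div, le_div_iff₀ h6]
  rcases hE0.eq_or_lt with h0 | h0
  · rw [← h0, zero_mul]
    exact Finset.sum_nonneg fun _ _ => sq_nonneg _
  · nlinarith

/-- The interaction of the other regressors with a group. -/
theorem groupNorm2_offDiag_le (Γ : Matrix (Idx t) (Idx t) ℝ) (hΓ : ∀ l, Γ l l = 1)
    (hs : ∀ l l', Γ l l' = Γ l' l) (u : Idx t → ℝ) (j : Fin p) :
    groupNorm2 (fun l => ∑ l', (Γ - 1) l l' * u l') j ≤ tauStar Γ * ∑ i, groupNorm1 u i := by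
  refine (groupNorm2_le_groupNorm1 _ j).trans ?_
  -- By symmetry the sum over the group falls on a row of `Γ - 1` attached to the outer regressor
  -- `l'`, which is the situation of `sum_abs_offDiag_le`.
  have hsymm : ∀ l l', (Γ - 1) l l' = (Γ - 1) l' l := fun l l' => by
    rw [Matrix.sub_apply, Matrix.sub_apply, hs, Matrix.one_apply, Matrix.one_apply]
    simp [eq_comm]
  calc groupNorm1 (fun l => ∑ l', (Γ - 1) l l' * u l') j
      ≤ ∑ s, ∑ l', |(Γ - 1) ⟨j, s⟩ l'| * |u l'| := Finset.sum_le_sum fun s _ =>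
        (Finset.abs_sum_le_sum_abs _ _).trans_eq (by simp_rw [abs_mul])
    _ = ∑ l', (∑ s, |(Γ - 1) l' ⟨j, s⟩|) * |u l'| := by
        rw [Finset.sum_comm]
        simp_rw [Finset.sum_mul]
        exact Finset.sum_congr rfl fun l' _ => Finset.sum_congr rfl fun s _ => by rw [hsymm]
    _ ≤ ∑ l', tauStar Γ * |u l'| := Finset.sum_le_sum fun l' _ =>
        mul_le_mul_of_nonneg_right (sum_abs_offDiag_le Γ hΓ l' j) (abs_nonneg _)
    _ = _ := by
        rw [← Finset.mul_sum, Fintype.sum_sigma]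
        rfl

end Gram

/-! ### The risk on a realisation of the noise -/

section Loss

variable {n p : ℕ} {t : Fin p → ℕ}

theorem eq_sqrt_mul_normDesign {nrm : Idx t → ℝ} (hn : ∀ l, 0 < nrm l)
    (X : Matrix (Fin n) (Idx t) ℝ) (i : Fin n) (l : Idx t) :
    X i l = √(nrm l) * normDesign nrm X i l := by
  have := (Real.sqrt_pos.2 (hn l)).ne'
  simp only [normDesign, Matrix.of_apply]
  field_simp

theorem corr_add (nrm : Idx t → ℝ) (X : Matrix (Fin n) (Idx t) ℝ) (Y W : Fin n → ℝ) (l : Idx t) :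
    corr nrm X (fun i => Y i + W i) l = corr nrm X Y l + corr nrm X W l := by
  simp only [corr, add_mul, Finset.sum_add_distrib]

theorem corr_mulVec {nrm : Idx t → ℝ} (hn : ∀ l, 0 < nrm l) (X : Matrix (Fin n) (Idx t) ℝ)
    (β : Idx t → ℝ) (l : Idx t) :
    corr nrm X (X *ᵥ β) l = ∑ l', gram nrm X l l' * (√(nrm l') * β l') := by
  simp only [corr, Matrix.mulVec, dotProduct, gram_apply, Finset.sum_mul]
  rw [Finset.sum_comm]
  refine Finset.sum_congr rfl fun l' _ => Finset.sum_congr rfl fun i _ => ?_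
  rw [eq_sqrt_mul_normDesign hn X i l']
  ring

theorem olsOn_of_notMem (X : Matrix (Fin n) (Idx t) ℝ) (Y : Fin n → ℝ) {B : Finset (Fin p)}
    {l : Idx t} (hl : l.1 ∉ B) : olsOn X Y B l = 0 := dif_neg hl

/-- A kernel vector, rescaled by `√(nrm l)`, solves the homogeneous normal equations of the
normalised design, and their stability forces it to vanish. -/
theorem isUnit_colsOf_gram {nrm : Idx t → ℝ} (hn : ∀ l, 0 < nrm l) (X : Matrix (Fin n) (Idx t) ℝ)
    (hΓ : ∀ l, gram nrm X l l = 1) {B : Finset (Fin p)} {ν : ℝ} (hν : ν < 1)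
    (hB : B.card * tauStar (gram nrm X) ≤ ν) : IsUnit ((colsOf X B)ᵀ * colsOf X B).det := by
  rw [← Matrix.isUnit_iff_isUnit_det, ← Matrix.mulVec_injective_iff_isUnit]
  rw [← Matrix.coe_mulVecLin, ← LinearMap.ker_eq_bot, LinearMap.ker_eq_bot']
  intro z hz
  set e : Idx t → ℝ := fun l => if h : l.1 ∈ B then √(nrm l) * z ⟨l, h⟩ else 0 with he
  have hsq := sum_sq_le_of_normalEq (gram nrm X) hΓ (gram_comm nrm X) B hν hB e 0 fun l hl => by
    have hl' := mem_idxOf.1 hl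
    have h0 : ∑ l' : {l : Idx t // l.1 ∈ B}, ((colsOf X B)ᵀ * colsOf X B) ⟨l, hl'⟩ l' * z l' = 0 :=
      congrFun hz ⟨l, hl'⟩
    rw [Finset.sum_subtype (idxOf t B) (p := fun l => l.1 ∈ B) (fun l => mem_idxOf)]
    have h1 : ∀ l' : {l : Idx t // l.1 ∈ B}, √(nrm l) * (gram nrm X l l' * e l') =
        ((colsOf X B)ᵀ * colsOf X B) ⟨l, hl'⟩ l' * z l' := fun l' => by
      have h2 : e l' = √(nrm l') * z l' := dif_pos l'.2
      rw [h2, gram_apply, Matrix.mul_apply]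
      simp only [Finset.sum_mul, Finset.mul_sum, colsOf, Matrix.transpose_apply,
        Matrix.submatrix_apply, id]
      refine Finset.sum_congr rfl fun i _ => ?_
      rw [eq_sqrt_mul_normDesign hn X i l, eq_sqrt_mul_normDesign hn X i l']
      ring
    have h3 : √(nrm l) * ∑ l' : {l : Idx t // l.1 ∈ B}, gram nrm X l l' * e l' = 0 := by
      rw [Finset.mul_sum, ← h0]
      exact Finset.sum_congr rfl fun l' _ => h1 l'
    exact (mul_eq_zero.1 h3).resolve_left (Real.sqrt_pos.2 (hn l)).ne'
  simp only [Pi.zero_apply, ne_eq, OfNat.ofNat_ne_zero, not_false_eq_true, zero_pow,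
    Finset.sum_const_zero, mul_zero] at hsq
  have hz0 := (Finset.sum_eq_zero_iff_of_nonneg fun l _ => sq_nonneg (e l)).1
    (le_antisymm hsq (Finset.sum_nonneg fun _ _ => sq_nonneg _))
  funext l
  have h4 : e l = 0 := by simpa using hz0 l (mem_idxOf.2 l.2)
  have h5 : e l = √(nrm l) * z l := dif_pos l.2
  rw [h5] at h4
  exact (mul_eq_zero.1 h4).resolve_left (Real.sqrt_pos.2 (hn l)).ne'

/-- The normal equations of the least squares estimator, in the normalised design. -/
theorem olsOn_normalEq {nrm : Idx t → ℝ} (hn : ∀ l, 0 < nrm l) (X : Matrix (Fin n) (Idx t) ℝ)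
    (hΓ : ∀ l, gram nrm X l l = 1) {B : Finset (Fin p)} {ν : ℝ} (hν : ν < 1)
    (hB : B.card * tauStar (gram nrm X) ≤ ν) (Y : Fin n → ℝ) {l : Idx t} (hl : l ∈ idxOf t B) :
    ∑ l' ∈ idxOf t B, gram nrm X l l' * (√(nrm l') * olsOn X Y B l') = corr nrm X Y l := by
  have hu := isUnit_colsOf_gram hn X hΓ hν hB
  have hl' := mem_idxOf.1 hl
  have h0 : ((colsOf X B)ᵀ * colsOf X B) *ᵥ
      ((((colsOf X B)ᵀ * colsOf X B)⁻¹ * (colsOf X B)ᵀ) *ᵥ Y) = (colsOf X B)ᵀ *ᵥ Y := by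
    rw [Matrix.mulVec_mulVec, ← Matrix.mul_assoc, Matrix.mul_nonsing_inv _ hu, Matrix.one_mul]
  have h1 := congrFun h0 ⟨l, hl'⟩
  set z := (((colsOf X B)ᵀ * colsOf X B)⁻¹ * (colsOf X B)ᵀ) *ᵥ Y with hz
  have h2 : √(nrm l) * ∑ l' ∈ idxOf t B, gram nrm X l l' * (√(nrm l') * olsOn X Y B l') =
      √(nrm l) * corr nrm X Y l := by
    rw [Finset.sum_subtype (idxOf t B) (p := fun l => l.1 ∈ B) (fun l => mem_idxOf)]
    calc _ = (((colsOf X B)ᵀ * colsOf X B) *ᵥ z) ⟨l, hl'⟩ := by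
          rw [Finset.mul_sum]
          refine Finset.sum_congr rfl fun l' _ => ?_
          have h2 : olsOn X Y B l' = z l' := dif_pos l'.2
          change _ = ((colsOf X B)ᵀ * colsOf X B) ⟨l, hl'⟩ l' * z l'
          rw [h2, gram_apply, Matrix.mul_apply]
          simp only [Finset.sum_mul, Finset.mul_sum, colsOf, Matrix.transpose_apply,
            Matrix.submatrix_apply, id]
          refine Finset.sum_congr rfl fun i _ => ?_
          rw [eq_sqrt_mul_normDesign hn X i l, eq_sqrt_mul_normDesign hn X i l']
          ring
      _ = _ := by
          rw [h1, corr, Finset.mul_sum]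
          simp only [Matrix.mulVec, dotProduct]
          refine Finset.sum_congr rfl fun i _ => ?_
          simp only [colsOf, Matrix.transpose_apply, Matrix.submatrix_apply, id]
          rw [eq_sqrt_mul_normDesign hn X i l]
          ring
  exact mul_left_cancel₀ (Real.sqrt_pos.2 (hn l)).ne' h2

/-- Total squared error of the least squares estimator on few groups. -/
theorem sum_sq_olsOn_sub_le {nrm : Idx t → ℝ} (hn : ∀ l, 0 < nrm l)
    (X : Matrix (Fin n) (Idx t) ℝ) (hΓ : ∀ l, gram nrm X l l = 1) {B : Finset (Fin p)} {ν : ℝ}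
    (hν : ν < 1) (hB : B.card * tauStar (gram nrm X) ≤ ν) (β : Idx t → ℝ) (w : Fin n → ℝ)
    {h : ℝ} (hh : tauStar (gram nrm X) * ∑ j, groupNorm1 (fun l => √(nrm l) * β l) j ≤ h) :
    ∑ l ∈ idxOf t B,
        (√(nrm l) * (olsOn X (fun i => (X *ᵥ β) i + w i) B l - β l)) ^ 2 ≤
      ((1 - ν) ^ 2)⁻¹ * ∑ j ∈ B, (h + groupNorm2 (corr nrm X w) j) ^ 2 := by
  set Γ := gram nrm X with hΓdef
  set α : Idx t → ℝ := fun l => √(nrm l) * β l with hα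
  -- The signal missed by the selection. The normalised error solves the normal equations on `B`
  -- whose right-hand side is the leakage of `u` plus the noise; since `u` vanishes on `B`, `Γ` may
  -- be replaced there by `Γ - 1`.
  set u : Idx t → ℝ := fun l => if l.1 ∈ B then 0 else α l with hu
  have hstab := sum_sq_le_of_normalEq Γ hΓ (gram_comm nrm X) B hν hB
    (fun l => √(nrm l) * (olsOn X (fun i => (X *ᵥ β) i + w i) B l - β l))
    (fun l => ∑ l', (Γ - 1) l l' * u l' + corr nrm X w l) fun l hl => by
      simp_rw [mul_sub, Finset.sum_sub_distrib]
      rw [olsOn_normalEq hn X hΓ hν hB _ hl, corr_add nrm X (X *ᵥ β), corr_mulVec hn X]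
      have h1 : ∑ l', (Γ - 1) l l' * u l' = ∑ l', Γ l l' * u l' := by
        have hul : u l = 0 := if_pos (mem_idxOf.1 hl)
        simp_rw [Matrix.sub_apply, sub_mul, Finset.sum_sub_distrib, Matrix.one_apply]
        simp [hul]
      have h2 : ∑ l', Γ l l' * (√(nrm l') * β l') =
          ∑ l' ∈ idxOf t B, Γ l l' * (√(nrm l') * β l') + ∑ l', Γ l l' * u l' := by
        rw [← Finset.sum_filter_add_sum_filter_not Finset.univ (fun l' => l' ∈ idxOf t B)]
        congr 1
        · congr 1
          ext; simp
        · rw [Finset.sum_filter]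
          refine Finset.sum_congr rfl fun l' _ => ?_
          simp only [mem_idxOf, hu, hα]
          split_ifs <;> simp_all
      rw [h1, h2]
      ring
  refine hstab.trans (mul_le_mul_of_nonneg_left ?_ (by positivity))
  rw [sum_idxOf]
  refine Finset.sum_le_sum fun j _ => ?_
  rw [← groupNorm2_sq (fun l => ∑ l', (Γ - 1) l l' * u l' + corr nrm X w l)]
  refine pow_le_pow_left₀ (groupNorm2_nonneg _ _) ?_ 2
  refine (groupNorm2_add_le _ _ j).trans (add_le_add_left ?_ _)
  refine (groupNorm2_offDiag_le Γ hΓ (gram_comm nrm X) u j).trans (le_trans ?_ hh)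
  refine mul_le_mul_of_nonneg_left (Finset.sum_le_sum fun i _ => Finset.sum_le_sum fun s _ => ?_)
    (tauStar_nonneg _)
  simp only [hu]
  split_ifs
  · simp
  · rfl

/-- Additional loss due to the second thresholding of a group. -/
theorem sum_sq_threshold_sub_le {N : ℝ} (hN : 0 < N) {nrm : Idx t → ℝ} (hn : ∀ l, N ≤ nrm l)
    (b β : Idx t → ℝ) (c : ℝ) (j : Fin p) (D : Fin (t j) → Prop) [DecidablePred D]
    (hD : ∀ s, D s ↔ c / √(nrm ⟨j, s⟩) ≤ groupNorm2 b j) :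
    ∑ s, ((if D s then b ⟨j, s⟩ else 0) - β ⟨j, s⟩) ^ 2 ≤
      2 * (∑ s, (b ⟨j, s⟩ - β ⟨j, s⟩) ^ 2) + 2 * (c ^ 2 / N) := by
  -- The cutoff varies inside a group through `nrm`, so part of a group may be removed; but a single
  -- removed coordinate already bounds the norm of the whole group.
  have h1 : ∑ s, (if D s then 0 else b ⟨j, s⟩ ^ 2) ≤ c ^ 2 / N := by
    by_cases h : ∀ s, D s
    · simp only [h, if_true, Finset.sum_const_zero]
      positivity
    · push Not at h
      obtain ⟨s, hs⟩ := h
      rw [hD] at hs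
      push Not at hs
      calc ∑ s, (if D s then 0 else b ⟨j, s⟩ ^ 2) ≤ ∑ s, b ⟨j, s⟩ ^ 2 :=
            Finset.sum_le_sum fun s _ => by split_ifs <;> simp [sq_nonneg]
        _ = groupNorm2 b j ^ 2 := (groupNorm2_sq b j).symm
        _ ≤ (c / √(nrm ⟨j, s⟩)) ^ 2 := pow_le_pow_left₀ (groupNorm2_nonneg _ _) hs.le 2
        _ = c ^ 2 / nrm ⟨j, s⟩ := by rw [div_pow, Real.sq_sqrt (hN.le.trans (hn _))]
        _ ≤ c ^ 2 / N := by gcongr; exact hn _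
  calc ∑ s, ((if D s then b ⟨j, s⟩ else 0) - β ⟨j, s⟩) ^ 2
      ≤ ∑ s, (2 * (b ⟨j, s⟩ - β ⟨j, s⟩) ^ 2 + 2 * (if D s then 0 else b ⟨j, s⟩ ^ 2)) := by
        refine Finset.sum_le_sum fun s _ => ?_
        split_ifs
        · nlinarith [sq_nonneg (b ⟨j, s⟩ - β ⟨j, s⟩)]
        · nlinarith [sq_nonneg (2 * b ⟨j, s⟩ - β ⟨j, s⟩)]
    _ ≤ _ := by
        rw [Finset.sum_add_distrib, ← Finset.mul_sum, ← Finset.mul_sum]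
        linarith

/-- Oracle-type bound of the loss when there are few leaders. -/
theorem loss_le {nrm : Idx t → ℝ} {N₀ : ℝ} (hN₀ : 0 < N₀) (hn : ∀ l, N₀ ≤ nrm l)
    (X : Matrix (Fin n) (Idx t) ℝ) (hΓ : ∀ l, gram nrm X l l = 1) {ν : ℝ} (hν0 : 0 < ν)
    (hν : ν < 1) (hτ : tauStar (gram nrm X) ≤ ν) (β : Idx t → ℝ) (w : Fin n → ℝ) {H T l₂ : ℝ}
    (hH : ∑ j, groupNorm1 (fun l => √(nrm l) * β l) j ≤ H) (hT0 : 0 < T)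
    (hT : 2 * H * tauStar (gram nrm X) / ν ≤ T) (hl₂ : 0 ≤ l₂) (hl₂T : l₂ ≤ T)
    (hcard : (leaders (numLeaders p ν (tauStar (gram nrm X))) T
      (groupNorm2 (corr nrm X fun i => (X *ᵥ β) i + w i))).card * tauStar (gram nrm X) ≤ ν) :
    ∑ l, (grlol ν T l₂ nrm X (fun i => (X *ᵥ β) i + w i) l - β l) ^ 2 ≤
      (1701 + 3200 * ((1 - ν) ^ 2)⁻¹) / N₀ *
        (∑ j, min (groupNorm2 (fun l => √(nrm l) * β l) j) T ^ 2 +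
          ∑ j, tailSq (9 / 20 * T) (groupNorm2 (corr nrm X w) j)) := by
  classical
  set τ := tauStar (gram nrm X) with hτdef
  set α : Idx t → ℝ := fun l => √(nrm l) * β l with hα
  set Y : Fin n → ℝ := fun i => (X *ᵥ β) i + w i with hY
  set V := groupNorm2 (corr nrm X w) with hV
  set ρ := groupNorm2 (corr nrm X Y) with hρ
  set N := numLeaders p ν τ with hNdef
  set B := leaders N T ρ with hB
  set D := ∑ j, min (groupNorm2 α j) T ^ 2 + ∑ j, tailSq (9 / 20 * T) (V j) with hD
  have hn0 : ∀ l, 0 < nrm l := fun l => hN₀.trans_le (hn l)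
  have hτ0 : 0 ≤ τ := tauStar_nonneg _
  have hH0 : 0 ≤ H := le_trans (Finset.sum_nonneg fun j _ => groupNorm1_nonneg _ j) hH
  have hHτ : H * τ ≤ ν * T / 2 := by
    rw [div_le_iff₀ hν0] at hT
    linarith
  have hbias : τ * ∑ j, groupNorm1 α j ≤ T / 2 := by
    have : τ * ∑ j, groupNorm1 α j ≤ τ * H := mul_le_mul_of_nonneg_left hH hτ0
    nlinarith
  have hdec : ∀ l, corr nrm X Y l =
      α l + (∑ l', (gram nrm X - 1) l l' * α l' + corr nrm X w l) := fun l => by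
    rw [hY, corr_add nrm X (X *ᵥ β), corr_mulVec hn0]
    simp_rw [Matrix.sub_apply, sub_mul, Finset.sum_sub_distrib, Matrix.one_apply]
    simp only [hα, ite_mul, one_mul, zero_mul, Finset.sum_ite_eq, Finset.mem_univ, if_true]
    ring
  set δ : Idx t → ℝ := fun l => ∑ l', (gram nrm X - 1) l l' * α l' + corr nrm X w l with hδ
  have hδn : ∀ j, groupNorm2 δ j ≤ T / 2 + V j := fun j =>
    (groupNorm2_add_le _ _ j).trans (add_le_add_left
      ((groupNorm2_offDiag_le _ hΓ (gram_comm nrm X) α j).trans hbias) _)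
  have h1 : ∀ j, ρ j ≤ groupNorm2 α j + T / 2 + V j := fun j => by
    have : ρ j ≤ groupNorm2 α j + groupNorm2 δ j := by
      rw [hρ, show corr nrm X Y = fun l => α l + δ l from funext hdec]
      exact groupNorm2_add_le α δ j
    linarith [hδn j]
  have h2 : ∀ j, groupNorm2 α j ≤ ρ j + T / 2 + V j := fun j => by
    have : groupNorm2 α j ≤ ρ j + groupNorm2 δ j := by
      rw [show α = fun l => corr nrm X Y l + -δ l from funext fun l => by rw [hdec]; ring,
        ← groupNorm2_neg δ]
      exact groupNorm2_add_le _ (fun l => -δ l) j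
    linarith [hδn j]
  -- Since `τ ≤ ν`, the integer part `N` is at least `1`, whence `ν / τ < N + 1 ≤ 2 N`. The factor
  -- `2` in the threshold compensates for this rounding.
  have hNcond : N = p ∨ H ≤ N * T := by
    rcases eq_or_ne τ 0 with h0 | h0
    · exact Or.inl (if_pos h0)
    · right
      have hτp : 0 < τ := lt_of_le_of_ne hτ0 h0.symm
      have hNe : N = ⌊ν / τ⌋₊ := if_neg h0
      have hx : 1 ≤ ν / τ := by rwa [one_le_div hτp]
      have hfl : (1 : ℝ) ≤ N := by
        rw [hNe]; exact_mod_cast Nat.one_le_floor_iff _ |>.2 hx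
      have hlt := Nat.lt_floor_add_one (ν / τ)
      rw [← hNe, div_lt_iff₀ hτp] at hlt
      have : ν ≤ 2 * N * τ := by nlinarith
      have : H * τ ≤ N * T * τ := by nlinarith
      exact le_of_mul_le_mul_right this hτp
  have hA1 : ∑ j, groupNorm2 α j ≤ H :=
    (Finset.sum_le_sum fun j _ => groupNorm2_le_groupNorm1 α j).trans hH
  have hnon := sum_nonleaders_le N (groupNorm2 α) V ρ hT0 (groupNorm2_nonneg α)
    (groupNorm2_nonneg _) h1 h2 hA1 hNcond
  have hlead : ∑ j ∈ B, (T ^ 2 + V j ^ 2) ≤ 800 * D := by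
    calc ∑ j ∈ B, (T ^ 2 + V j ^ 2)
        ≤ ∑ j ∈ B, 800 * (min (groupNorm2 α j) T ^ 2 + tailSq (9 / 20 * T) (V j)) :=
          Finset.sum_le_sum fun j hj => leader_cost_le hT0.le (groupNorm2_nonneg _ j)
            ((mem_leaders hT0.le (groupNorm2_nonneg _) j).1 hj).1 (h1 j)
      _ ≤ ∑ j, 800 * (min (groupNorm2 α j) T ^ 2 + tailSq (9 / 20 * T) (V j)) :=
          Finset.sum_le_sum_of_subset_of_nonneg (Finset.subset_univ _) fun j _ _ => by
            have := tailSq_nonneg (9 / 20 * T) (V j)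
            positivity
      _ = 800 * D := by rw [← Finset.mul_sum, Finset.sum_add_distrib]
  have hols := sum_sq_olsOn_sub_le hn0 X hΓ hν hcard β w hbias
  rw [sum_idxOf] at hols
  set K := ((1 - ν) ^ 2)⁻¹ with hK
  have hK0 : 0 ≤ K := by positivity
  have hols' : ∑ j ∈ B, ∑ s, (√(nrm ⟨j, s⟩) * (olsOn X Y B ⟨j, s⟩ - β ⟨j, s⟩)) ^ 2 ≤
      K * (1600 * D) := by
    refine hols.trans (mul_le_mul_of_nonneg_left ?_ hK0)
    calc ∑ j ∈ B, (T / 2 + V j) ^ 2 ≤ ∑ j ∈ B, 2 * (T ^ 2 + V j ^ 2) :=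
          Finset.sum_le_sum fun j _ => by nlinarith [sq_nonneg (T / 2 - V j)]
      _ ≤ 1600 * D := by rw [← Finset.mul_sum]; linarith
  have hscale : ∀ (l : Idx t) (x : ℝ), x ^ 2 ≤ (√(nrm l) * x) ^ 2 / N₀ := fun l x => by
    rw [le_div_iff₀ hN₀, mul_pow, Real.sq_sqrt (hn0 l).le, mul_comm]
    exact mul_le_mul_of_nonneg_right (hn l) (sq_nonneg x)
  have hgroup : ∀ j, ∑ s, (grlol ν T l₂ nrm X Y ⟨j, s⟩ - β ⟨j, s⟩) ^ 2 ≤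
      (if j ∈ B then 2 * ∑ s, (√(nrm ⟨j, s⟩) * (olsOn X Y B ⟨j, s⟩ - β ⟨j, s⟩)) ^ 2
        + 2 * (T ^ 2 + V j ^ 2) else groupNorm2 α j ^ 2) / N₀ := fun j => by
    split_ifs with hj
    · have h3 := sum_sq_threshold_sub_le hN₀ hn (olsOn X Y B) β l₂ j
        (fun s => l₂ / √(nrm ⟨j, s⟩) ≤ groupNorm2 (olsOn X Y B) j) fun s => Iff.rfl
      have h4 : ∑ s, (olsOn X Y B ⟨j, s⟩ - β ⟨j, s⟩) ^ 2 ≤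
          (∑ s, (√(nrm ⟨j, s⟩) * (olsOn X Y B ⟨j, s⟩ - β ⟨j, s⟩)) ^ 2) / N₀ := by
        rw [Finset.sum_div]
        exact Finset.sum_le_sum fun s _ => hscale _ _
      -- A leader is already charged `T²`, and the second threshold does not exceed `T`.
      have h5 : l₂ ^ 2 / N₀ ≤ (T ^ 2 + V j ^ 2) / N₀ := by
        gcongr
        nlinarith [sq_nonneg (V j)]
      have h6 : ∑ s, (grlol ν T l₂ nrm X Y ⟨j, s⟩ - β ⟨j, s⟩) ^ 2 = ∑ s,
          ((if l₂ / √(nrm ⟨j, s⟩) ≤ groupNorm2 (olsOn X Y B) j then olsOn X Y B ⟨j, s⟩ else 0)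
            - β ⟨j, s⟩) ^ 2 := by
        refine Finset.sum_congr rfl fun s _ => ?_
        simp only [grlol, prelim]
        congr!
      rw [h6, add_div, mul_div_assoc, mul_div_assoc]
      linarith
    · have h7 : ∀ s, grlol ν T l₂ nrm X Y ⟨j, s⟩ = 0 := fun s => by
        have : prelim ν T nrm X Y ⟨j, s⟩ = 0 := olsOn_of_notMem X Y hj
        simp only [grlol, this, ite_self]
      simp_rw [h7, zero_sub, neg_sq]
      rw [groupNorm2_sq, Finset.sum_div]
      exact Finset.sum_le_sum fun s _ => hscale _ _
  rw [Fintype.sum_sigma]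
  refine (Finset.sum_le_sum fun j _ => hgroup j).trans ?_
  rw [← Finset.sum_div, Finset.sum_ite, div_mul_eq_mul_div]
  refine div_le_div_of_nonneg_right ?_ hN₀.le
  rw [Finset.sum_add_distrib, ← Finset.mul_sum, ← Finset.mul_sum, Finset.filter_univ_mem]
  linarith

end Loss

/-! ### The noise in the groups -/

section Noise

variable {n p : ℕ} {t : Fin p → ℕ}

theorem measurable_corr (nrm : Idx t → ℝ) (X : Matrix (Fin n) (Idx t) ℝ) (l : Idx t) :
    Measurable fun Y => corr nrm X Y l := by
  unfold corr
  fun_prop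

theorem measurable_groupNorm2 {Ω : Type*} [MeasurableSpace Ω] {u : Ω → Idx t → ℝ}
    (hu : ∀ l, Measurable fun ω => u ω l) (j : Fin p) :
    Measurable fun ω => groupNorm2 (u ω) j := by
  unfold groupNorm2
  exact (Finset.measurable_sum _ fun s _ => (hu _).pow_const 2).sqrt

theorem measurableSet_leaders_eq {Ω : Type*} [MeasurableSpace Ω] {ρ : Ω → Fin p → ℝ}
    (hρ : ∀ j, Measurable fun ω => ρ ω j) (N : ℕ) (l : ℝ) (B : Finset (Fin p)) :
    MeasurableSet {ω | leaders N l (ρ ω) = B} := by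
  classical
  have hmem : ∀ j, MeasurableSet {ω | j ∈ leaders N l (ρ ω)} := fun j => by
    simp only [leaders, Finset.mem_filter, Finset.mem_univ, true_and, Finset.card_filter]
    have h1 : MeasurableSet {ω | l ^ 2 ≤ ρ ω j ^ 2} :=
      measurableSet_le measurable_const ((hρ j).pow_const 2)
    have h2 : Measurable fun ω => ∑ i, if ρ ω j ^ 2 < ρ ω i ^ 2 then 1 else 0 :=
      Finset.measurable_sum _ fun i _ => Measurable.ite
        (measurableSet_lt ((hρ j).pow_const 2) ((hρ i).pow_const 2)) measurable_const
        measurable_const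
    exact h1.inter (measurableSet_lt h2 measurable_const)
  have : {ω | leaders N l (ρ ω) = B} = ⋂ j, {ω | j ∈ leaders N l (ρ ω) ↔ j ∈ B} := by
    ext ω
    simp [Finset.ext_iff]
  rw [this]
  refine MeasurableSet.iInter fun j => ?_
  by_cases hj : j ∈ B
  · simp only [hj, iff_true]
    exact hmem j
  · simp only [hj, iff_false]
    exact (hmem j).compl

theorem measurable_olsOn (X : Matrix (Fin n) (Idx t) ℝ) (B : Finset (Fin p)) (l : Idx t) :
    Measurable fun Y => olsOn X Y B l := by
  unfold olsOn
  split_ifs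
  · simp only [Matrix.mulVec, dotProduct]
    fun_prop
  · exact measurable_const

/-- The random set of leaders takes finitely many values, and on each of the corresponding events
the estimator is linear in `Y`. -/
theorem measurable_prelim (ν l₁ : ℝ) (nrm : Idx t → ℝ) (X : Matrix (Fin n) (Idx t) ℝ)
    (l : Idx t) : Measurable fun Y => prelim ν l₁ nrm X Y l := by
  classical
  have h : (fun Y => prelim ν l₁ nrm X Y l) = fun Y => ∑ B : Finset (Fin p),
      if leaders (numLeaders p ν (tauStar (gram nrm X))) l₁ (groupNorm2 (corr nrm X Y)) = B
        then olsOn X Y B l else 0 := by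
    funext Y
    simp [prelim]
  rw [h]
  refine Finset.measurable_sum _ fun B _ => Measurable.ite ?_ (measurable_olsOn X B l)
    measurable_const
  exact measurableSet_leaders_eq (fun j => measurable_groupNorm2 (measurable_corr nrm X) j) _ _ _

theorem measurable_grlol (ν l₁ l₂ : ℝ) (nrm : Idx t → ℝ) (X : Matrix (Fin n) (Idx t) ℝ)
    (l : Idx t) : Measurable fun Y => grlol ν l₁ l₂ nrm X Y l := by
  unfold grlol
  exact Measurable.ite (measurableSet_le measurable_const
    (measurable_groupNorm2 (measurable_prelim ν l₁ nrm X) _)) (measurable_prelim ν l₁ nrm X l)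
    measurable_const

/-- Almost surely, no two groups have the same correlation with the observations. -/
theorem ae_groupNorm2_corr_ne (hpos : ∀ j, 1 ≤ t j) (nrm : Idx t → ℝ)
    (X : Matrix (Fin n) (Idx t) ℝ) (hΓ : ∀ l, gram nrm X l l = 1)
    (hτ : tauStar (gram nrm X) < 1) (m : Fin n → ℝ) (v : ℝ≥0) (hv : v ≠ 0) :
    ∀ᵐ w ∂Measure.pi (fun _ : Fin n => gaussianReal 0 v), ∀ i j, i ≠ j →
      groupNorm2 (corr nrm X fun k => m k + w k) i ^ 2 ≠
        groupNorm2 (corr nrm X fun k => m k + w k) j ^ 2 := by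
  rw [ae_all_iff]; intro i
  rw [ae_all_iff]; intro j
  rw [Filter.eventually_imp_distrib_left]
  intro hij
  set Γ := gram nrm X
  -- The noise is moved along a normalised column of group `i`. The leading coefficient of the
  -- difference of squared norms is then at least `1 - τ*² > 0`: group `i` contains the diagonal
  -- entry `1`, while group `j` contributes at most `τ*²`.
  set l : Idx t := ⟨i, ⟨0, hpos i⟩⟩ with hl
  have hcorr : ∀ (w : Fin n → ℝ) (s : ℝ) (l' : Idx t),
      corr nrm X (fun k => m k + (w + s • fun k => normDesign nrm X k l) k) l' =
        corr nrm X (fun k => m k + w k) l' + s * Γ l l' := fun w s l' => by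
    simp only [corr, Γ, gram_apply, Finset.mul_sum, ← Finset.sum_add_distrib, Pi.add_apply,
      Pi.smul_apply, smul_eq_mul]
    exact Finset.sum_congr rfl fun k _ => by ring
  have hlead : ∑ s, Γ l ⟨i, s⟩ ^ 2 - ∑ s, Γ l ⟨j, s⟩ ^ 2 ≠ 0 := by
    have h1 : 1 ≤ ∑ s, Γ l ⟨i, s⟩ ^ 2 := by
      have : Γ l ⟨i, ⟨0, hpos i⟩⟩ ^ 2 ≤ ∑ s, Γ l ⟨i, s⟩ ^ 2 :=
        Finset.single_le_sum (f := fun s => Γ l ⟨i, s⟩ ^ 2) (fun _ _ => sq_nonneg _)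
          (Finset.mem_univ _)
      rwa [← hl, hΓ, one_pow] at this
    have h2 : ∑ s, |Γ l ⟨j, s⟩| ≤ tauStar Γ := by
      refine le_of_eq_of_le (Finset.sum_congr rfl fun s _ => ?_) (sum_abs_offDiag_le Γ hΓ l j)
      rw [Matrix.sub_apply, Matrix.one_apply_ne (fun h => hij (congrArg Sigma.fst h)), sub_zero]
    have h3 : ∑ s, Γ l ⟨j, s⟩ ^ 2 ≤ (∑ s, |Γ l ⟨j, s⟩|) ^ 2 := by
      simp_rw [← sq_abs (Γ l _)]
      exact Finset.sum_sq_le_sq_sum_of_nonneg fun _ _ => abs_nonneg _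
    have h4 : 0 ≤ ∑ s, |Γ l ⟨j, s⟩| := Finset.sum_nonneg fun _ _ => abs_nonneg _
    have : ∑ s, Γ l ⟨j, s⟩ ^ 2 < 1 := by nlinarith
    linarith
  have hmeas : ∀ j, Measurable fun w : Fin n → ℝ =>
      groupNorm2 (corr nrm X fun k => m k + w k) j ^ 2 := fun j =>
    (measurable_groupNorm2 (fun l => (measurable_corr nrm X l).comp
      (measurable_pi_lambda _ fun k => by fun_prop)) j).pow_const 2
  have := ae_ne_zero_of_quadratic v hv (fun w =>
      groupNorm2 (corr nrm X fun k => m k + w k) i ^ 2 -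
        groupNorm2 (corr nrm X fun k => m k + w k) j ^ 2) ((hmeas i).sub (hmeas j))
    (fun k => normDesign nrm X k l) _ hlead fun w => by
      refine ⟨2 * (∑ s, corr nrm X (fun k => m k + w k) ⟨i, s⟩ * Γ l ⟨i, s⟩ -
        ∑ s, corr nrm X (fun k => m k + w k) ⟨j, s⟩ * Γ l ⟨j, s⟩),
        ∑ s, corr nrm X (fun k => m k + w k) ⟨i, s⟩ ^ 2 -
          ∑ s, corr nrm X (fun k => m k + w k) ⟨j, s⟩ ^ 2, fun s => ?_⟩
      have hexp : ∀ j, ∑ r, (corr nrm X (fun k => m k + w k) ⟨j, r⟩ + s * Γ l ⟨j, r⟩) ^ 2 =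
          (∑ r, Γ l ⟨j, r⟩ ^ 2) * s ^ 2 +
            2 * (∑ r, corr nrm X (fun k => m k + w k) ⟨j, r⟩ * Γ l ⟨j, r⟩) * s +
            ∑ r, corr nrm X (fun k => m k + w k) ⟨j, r⟩ ^ 2 := fun j => by
        simp_rw [Finset.mul_sum, Finset.sum_mul, ← Finset.sum_add_distrib]
        exact Finset.sum_congr rfl fun r _ => by ring
      simp_rw [groupNorm2_sq, hcorr, hexp]
      ring
  filter_upwards [this] with w hw
  exact sub_ne_zero.1 hw

/-- Second moment of the noise in a group, where it is large. -/
theorem integral_tailSq_le (nrm : Idx t → ℝ) (X : Matrix (Fin n) (Idx t) ℝ)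
    (hΓ : ∀ l, gram nrm X l l = 1) {ν : ℝ} (hν : 0 < ν) (hτ : tauStar (gram nrm X) ≤ ν)
    (v : ℝ≥0) (hv : v ≠ 0) (x : ℝ) (j : Fin p) :
    Integrable (fun w => tailSq x (groupNorm2 (corr nrm X w) j))
      (Measure.pi fun _ : Fin n => gaussianReal 0 v) ∧
    ∫ w, tailSq x (groupNorm2 (corr nrm X w) j)
        ∂(Measure.pi fun _ : Fin n => gaussianReal 0 v) ≤
      200 / 3 * (v * (1 + ν)) * Real.exp (-(9 / 25) * (x ^ 2 / (v * (1 + ν)))) * 2 ^ t j := by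
  -- The case of a single group in the near-orthogonality estimate: the Gram block of a group has
  -- eigenvalues at most `1 + τ* ≤ 1 + ν`.
  have hA : ∀ g : Fin (t j) → ℝ,
      ∑ i, (∑ s, normDesign nrm X i ⟨j, s⟩ * g s) ^ 2 ≤ (1 + ν) * ∑ s, g s ^ 2 := fun g => by
    classical
    set e : Idx t → ℝ := fun l => if h : l.1 = j then g (h ▸ l.2) else 0 with he
    have hes : ∀ s, e ⟨j, s⟩ = g s := fun s => by simp [he]
    have h1 := (abs_le.1 (abs_quadForm_sub_le (gram nrm X) hΓ (gram_comm nrm X) {j} e)).2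
    simp only [sum_idxOf, Finset.sum_singleton, hes, Finset.card_singleton, Nat.cast_one,
      one_mul] at h1
    have h2 : ∑ i, (∑ s, normDesign nrm X i ⟨j, s⟩ * g s) ^ 2 =
        ∑ s, ∑ s', g s * gram nrm X ⟨j, s⟩ ⟨j, s'⟩ * g s' := by
      simp_rw [sq, Finset.sum_mul_sum, gram_apply, Finset.mul_sum, Finset.sum_mul]
      rw [Finset.sum_comm]
      refine Finset.sum_congr rfl fun s _ => ?_
      rw [Finset.sum_comm]
      exact Finset.sum_congr rfl fun s' _ => Finset.sum_congr rfl fun i _ => by ring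
    have h3 : 0 ≤ ∑ s, g s ^ 2 := Finset.sum_nonneg fun _ _ => sq_nonneg _
    nlinarith
  have hlint := lintegral_tail_sq_norm_le (fun i s => normDesign nrm X i ⟨j, s⟩) v hv (1 + ν)
    (by linarith) hA (x ^ 2)
  have heq : ∀ w : Fin n → ℝ, tailSq x (groupNorm2 (corr nrm X w) j) =
      if x ^ 2 ≤ ∑ s, (∑ i, w i * normDesign nrm X i ⟨j, s⟩) ^ 2 then
        ∑ s, (∑ i, w i * normDesign nrm X i ⟨j, s⟩) ^ 2 else 0 := fun w => by
    rw [tailSq, groupNorm2_sq]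
    rfl
  simp_rw [← heq, Fintype.card_fin] at hlint
  have hmeas : Measurable fun w => tailSq x (groupNorm2 (corr nrm X w) j) := by
    have h4 := (measurable_groupNorm2 (measurable_corr nrm X) j).pow_const 2
    exact Measurable.ite (measurableSet_le measurable_const h4) h4 measurable_const
  have h0 : ∀ w, 0 ≤ tailSq x (groupNorm2 (corr nrm X w) j) := fun w => tailSq_nonneg _ _
  refine ⟨⟨hmeas.aestronglyMeasurable, ?_⟩, ?_⟩
  · rw [hasFiniteIntegral_iff_ofReal (ae_of_all _ h0)]
    exact hlint.trans_lt ENNReal.ofReal_lt_top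
  · rw [integral_eq_lintegral_of_nonneg_ae (ae_of_all _ h0) hmeas.aestronglyMeasurable]
    exact ENNReal.toReal_le_of_le_ofReal (by positivity) hlint

end Noise

/-! ### The rate -/

section Rate

variable {p : ℕ} {t : Fin p → ℕ}

/-- Each `x j / H` lies in `[0, 1]`, where raising to a power `q ≤ 1` does not decrease it. -/
theorem sum_le_of_sum_rpow_le {ι : Type*} [Fintype ι] {q H : ℝ} (hq0 : 0 < q) (hq1 : q ≤ 1)
    (hH : 0 < H) (x : ι → ℝ) (hx : ∀ j, 0 ≤ x j) (h : ∑ j, x j ^ q ≤ H ^ q) :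
    ∑ j, x j ≤ H := by
  have hle : ∀ j, x j ≤ H := fun j => by
    have h1 : x j ^ q ≤ H ^ q := (Finset.single_le_sum (f := fun j => x j ^ q)
      (fun i _ => Real.rpow_nonneg (hx i) q) (Finset.mem_univ j)).trans h
    exact (Real.rpow_le_rpow_iff (hx j) hH.le hq0).1 h1
  have hpt : ∀ j, x j ≤ H * (x j ^ q / H ^ q) := fun j => by
    rw [← Real.div_rpow (hx j) hH.le]
    have h2 : x j / H ≤ (x j / H) ^ q := by
      have := Real.rpow_le_rpow_of_exponent_ge' (div_nonneg (hx j) hH.le)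
        ((div_le_one hH).2 (hle j)) hq0.le hq1
      rwa [Real.rpow_one] at this
    calc x j = H * (x j / H) := by field_simp
      _ ≤ _ := by gcongr
  calc ∑ j, x j ≤ ∑ j, H * (x j ^ q / H ^ q) := Finset.sum_le_sum fun j _ => hpt j
    _ = H * ((∑ j, x j ^ q) / H ^ q) := by rw [← Finset.mul_sum, Finset.sum_div]
    _ ≤ H * 1 := by
        gcongr
        exact (div_le_one (Real.rpow_pos_of_pos hH q)).2 h
    _ = H := mul_one H

theorem min_sq_le_rpow {x y T q : ℝ} (hx : 0 ≤ x) (hxy : x ≤ y) (hT : 0 < T) (hq0 : 0 < q)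
    (hq1 : q ≤ 1) : min x T ^ 2 ≤ T ^ (2 - q) * y ^ q := by
  have hm : 0 ≤ min x T := le_min hx hT.le
  rcases hm.eq_or_lt with h0 | h0
  · rw [← h0, zero_pow two_ne_zero]
    exact mul_nonneg (Real.rpow_nonneg hT.le _) (Real.rpow_nonneg (hx.trans hxy) _)
  · calc min x T ^ 2 = min x T ^ (2 - q) * min x T ^ q := by
          rw [← Real.rpow_add h0, sub_add_cancel, Real.rpow_two]
      _ ≤ _ := mul_le_mul (Real.rpow_le_rpow hm (min_le_right _ _) (by linarith))
          (Real.rpow_le_rpow hm ((min_le_left _ _).trans hxy) hq0.le) (Real.rpow_nonneg hm _)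
          (Real.rpow_nonneg hT.le _)

/-- Used to make the final constant independent of `q`. -/
theorem rpow_le_max_one {x s : ℝ} (hx : 0 ≤ x) (hs0 : 0 ≤ s) (hs1 : s ≤ 1) :
    x ^ s ≤ max 1 x := by
  rcases le_total x 1 with h | h
  · exact (Real.rpow_le_one hx h hs0).trans (le_max_left _ _)
  · calc x ^ s ≤ x ^ (1 : ℝ) := Real.rpow_le_rpow_of_exponent_le h hs1
      _ = x := Real.rpow_one x
      _ ≤ _ := le_max_right _ _

theorem min_one_le_rpow {x y s : ℝ} (hy : 0 < y) (hx : y ≤ x) (hs0 : 0 ≤ s) (hs1 : s ≤ 1) :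
    min 1 y ≤ x ^ s := by
  rcases le_total x 1 with h | h
  · calc min 1 y ≤ x := (min_le_right _ _).trans hx
      _ = x ^ (1 : ℝ) := (Real.rpow_one x).symm
      _ ≤ x ^ s := Real.rpow_le_rpow_of_exponent_ge' (hy.le.trans hx) h hs0 hs1
  · exact (min_le_left _ _).trans (Real.one_le_rpow h hs0)

/-- As `t*` is an integer, `t* ≤ t*²`. Thus the part `M² v r*` of the threshold stays within the
rate. -/
theorem rStar_le_tauStar_sq (Γ : Matrix (Idx t) (Idx t) ℝ) : rStar Γ ≤ tauStar Γ ^ 2 := by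
  unfold rStar tauStar
  have h1 : (tStar t : ℝ) ≤ (tStar t : ℝ) ^ 2 := by exact_mod_cast Nat.le_self_pow two_ne_zero _
  have h2 := mul_nonneg (mul_nonneg (Nat.cast_nonneg (α := ℝ) (tStar t)) (gammaBT_nonneg Γ))
    (gammaBG_nonneg Γ)
  nlinarith [mul_le_mul_of_nonneg_right h1 (sq_nonneg (gammaBT Γ))]

theorem oneMinInv_le_one (r : ℝ) : oneMinInv r ≤ 1 := by
  unfold oneMinInv
  split_ifs
  · exact le_rfl
  · exact min_le_left _ _

theorem kap_pos {ν : ℝ} (hν : ν < 1) : 0 < kap ν :=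
  lt_of_lt_of_le (inv_pos.2 (by linarith)) (le_max_left _ _)

theorem inv_cA_le {M q c₁ ν : ℝ} (hM : 0 < M) (hq0 : 0 < q) (hq1 : q ≤ 1) (hc : 1 ≤ c₁) :
    (cA M q c₁ ν)⁻¹ ≤ max 1 M := by
  unfold cA
  have h1 : 1 ≤ max (9 / 4 * c₁ ^ 2) (3 * kap ν) := le_max_of_le_left (by nlinarith)
  rw [mul_inv, Real.rpow_neg hM.le, inv_inv]
  calc M ^ q * (max (9 / 4 * c₁ ^ 2) (3 * kap ν))⁻¹ ≤ M ^ q * 1 := by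
        gcongr
        exact inv_le_one_of_one_le₀ h1
    _ ≤ max 1 M := by
        rw [mul_one]
        exact rpow_le_max_one hM.le hq0.le hq1

theorem cB_nonneg {c₁ c₂ ν : ℝ} (hν0 : 0 < ν) (hν : ν < 1) : 0 ≤ cB c₁ c₂ ν := by
  have := kap_pos hν
  exact le_min (by positivity) (by positivity)

/-- The expected contribution of the groups whose noise is large is of the order of the rate. -/
theorem card_mul_tail_le {ν σ M v v₀ q c₁ c₂ lam T L o : ℝ} {k : ℕ} (hν0 : 0 < ν) (hν : ν < 1)
    (hσ : 0 < σ) (hM : 0 < M) (hv : 0 < v) (hv₀ : 0 < v₀) (hσv : 1 < σ → v₀ ≤ v) (hq0 : 0 < q)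
    (hq1 : q ≤ 1) (hc : 5 ≤ c₁) (hL : 1 ≤ L) (hp : 1 ≤ p) (hpL : Real.log p ≤ L) (hk : k ≤ L)
    (hlam0 : 0 < lam) (hlam : σ ^ 2 * (1 + ν) * L ≤ lam ^ 2) (hT : c₁ * lam ≤ T) (ho : o ≤ 1)
    (hpc : (p : ℝ) ≤ (cA M q c₁ ν)⁻¹ * v ^ (q / 2) * lam ^ (-q) *
      Real.exp (cB c₁ c₂ ν * lam ^ 2 * o)) :
    p * (200 / 3 * (σ ^ 2 * (1 + ν)) *
        Real.exp (-(9 / 25) * ((9 / 20 * T) ^ 2 / (σ ^ 2 * (1 + ν)))) * 2 ^ k) ≤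
      200 / 3 * max (max 1 M) (2 * σ ^ 2 / min 1 v₀) * (T ^ (2 - q) * v ^ (q / 2)) := by
  set S := σ ^ 2 * (1 + ν) with hS
  have hS0 : 0 < S := by positivity
  -- The scale of all exponents below: `c₁ ≥ 5` gives `x ≥ 25 L`, the noise tail contributes
  -- `-(9/25)(9/20)² x = -(729/10000) x`, and `2 ^ k ≤ exp (7 L / 10)`.
  set x := c₁ ^ 2 * lam ^ 2 / S with hx
  have hxL : 25 * L ≤ x := by
    rw [hx, le_div_iff₀ hS0]
    have h1 : 25 ≤ c₁ ^ 2 := by nlinarith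
    have h2 : 0 ≤ S * L := by positivity
    nlinarith
  have hTx : x ≤ T ^ 2 / S := by
    rw [hx, ← mul_pow]
    gcongr
  have hT0 : 0 < T := lt_of_lt_of_le (by positivity) hT
  have hexp : Real.exp (-(9 / 25) * ((9 / 20 * T) ^ 2 / S)) * 2 ^ k ≤
      Real.exp (-(729 / 10000) * x + 7 / 10 * L) := by
    rw [← Real.exp_log (show (0 : ℝ) < 2 ^ k by positivity), Real.log_pow, ← Real.exp_add]
    apply Real.exp_le_exp.2
    have h3 : (9 / 20 * T) ^ 2 / S = 81 / 400 * (T ^ 2 / S) := by ring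
    have h4 : (k : ℝ) * Real.log 2 ≤ L * (7 / 10) :=
      mul_le_mul hk (by linarith [Real.log_two_lt_d9]) (Real.log_nonneg (by norm_num))
        (by linarith)
    rw [h3]
    linarith
  have hrate0 : 0 ≤ T ^ (2 - q) * v ^ (q / 2) := by positivity
  have hp0 : (0 : ℝ) < p := by exact_mod_cast hp
  suffices h : p * S * Real.exp (-(729 / 10000) * x + 7 / 10 * L) ≤
      max (max 1 M) (2 * σ ^ 2 / min 1 v₀) * (T ^ (2 - q) * v ^ (q / 2)) by
    calc _ = 200 / 3 * (p * S *
          (Real.exp (-(9 / 25) * ((9 / 20 * T) ^ 2 / S)) * 2 ^ k)) := by ring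
      _ ≤ 200 / 3 * (p * S * Real.exp (-(729 / 10000) * x + 7 / 10 * L)) := by gcongr
      _ ≤ 200 / 3 * (max (max 1 M) (2 * σ ^ 2 / min 1 v₀) * (T ^ (2 - q) * v ^ (q / 2))) := by
          gcongr
      _ = _ := by ring
  have hlamT : lam ≤ T := le_trans (by nlinarith) hT
  -- For `σ ≤ 1` the bound on `p` costs at most `exp (x / 64)`, which the tail absorbs, and its
  -- prefactor `v^{q/2} lam^{-q}` supplies the rate. For `σ > 1` this comparison fails, because
  -- `c_b` does not contain `σ`.
  rcases le_or_gt σ 1 with hσ1 | hσ1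
  · refine le_trans ?_ (mul_le_mul_of_nonneg_right (le_max_left _ _) hrate0)
    have hcB : cB c₁ c₂ ν * lam ^ 2 * o ≤ x / 64 := by
      have h5 := cB_nonneg (c₁ := c₁) (c₂ := c₂) hν0 hν
      calc cB c₁ c₂ ν * lam ^ 2 * o ≤ cB c₁ c₂ ν * lam ^ 2 :=
            mul_le_of_le_one_right (by positivity) ho
        _ ≤ c₁ ^ 2 / (64 * (1 + ν)) * lam ^ 2 := by
            gcongr
            exact min_le_left _ _
        _ = c₁ ^ 2 * lam ^ 2 / (1 + ν) / 64 := by field_simp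
        _ ≤ c₁ ^ 2 * lam ^ 2 / S / 64 := by
            gcongr
            rw [hS]
            have : σ ^ 2 ≤ 1 := by nlinarith
            nlinarith
    have hSl : S * lam ^ (-q) ≤ T ^ (2 - q) := by
      calc S * lam ^ (-q) ≤ lam ^ 2 * lam ^ (-q) := by
            gcongr
            nlinarith
        _ = lam ^ (2 - q) := by
            rw [← Real.rpow_two, ← Real.rpow_add hlam0]
            ring_nf
        _ ≤ T ^ (2 - q) := Real.rpow_le_rpow hlam0.le hlamT (by linarith)
    have hA := inv_cA_le (ν := ν) hM hq0 hq1 (by linarith : (1 : ℝ) ≤ c₁)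
    calc p * S * Real.exp (-(729 / 10000) * x + 7 / 10 * L)
        ≤ ((cA M q c₁ ν)⁻¹ * v ^ (q / 2) * lam ^ (-q) *
            Real.exp (cB c₁ c₂ ν * lam ^ 2 * o)) * S *
            Real.exp (-(729 / 10000) * x + 7 / 10 * L) := by gcongr
      _ = (cA M q c₁ ν)⁻¹ * (v ^ (q / 2) * (S * lam ^ (-q)) *
            Real.exp (cB c₁ c₂ ν * lam ^ 2 * o + (-(729 / 10000) * x + 7 / 10 * L))) := by
          rw [Real.exp_add (cB c₁ c₂ ν * lam ^ 2 * o)]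
          ring
      _ ≤ max 1 M * (v ^ (q / 2) * T ^ (2 - q) * 1) := by
          gcongr
          exact Real.exp_le_one_iff.2 (by linarith)
      _ = _ := by ring
  -- Here `p ≤ exp L` suffices, as `25 · 729/10000 > 17/10`. What remains is of order `σ²`, which is
  -- dominated by `T^{2-q} v^{q/2}` because `T ≥ 1` and `v ≥ v₀`.
  · refine le_trans ?_ (mul_le_mul_of_nonneg_right (le_max_right _ _) hrate0)
    have hpe : p * Real.exp (-(729 / 10000) * x + 7 / 10 * L) ≤ 1 := by
      rw [← Real.exp_log hp0, ← Real.exp_add]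
      exact Real.exp_le_one_iff.2 (by linarith)
    have hT1 : 1 ≤ T ^ (2 - q) := by
      refine Real.one_le_rpow ?_ (by linarith)
      have h6 : 1 ≤ S * L :=
        one_le_mul_of_one_le_of_one_le
          (one_le_mul_of_one_le_of_one_le (one_le_pow₀ hσ1.le) (by linarith)) hL
      exact ((one_le_sq_iff₀ hlam0.le).1 (h6.trans hlam)).trans hlamT
    have hvq : min 1 v₀ ≤ v ^ (q / 2) :=
      min_one_le_rpow hv₀ (hσv hσ1) (by linarith) (by linarith)
    have hmin : 0 < min 1 v₀ := lt_min one_pos hv₀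
    calc p * S * Real.exp (-(729 / 10000) * x + 7 / 10 * L)
        = S * (p * Real.exp (-(729 / 10000) * x + 7 / 10 * L)) := by ring
      _ ≤ S * 1 := by gcongr
      _ ≤ 2 * σ ^ 2 := by
          rw [hS, mul_one, mul_comm]
          gcongr
          linarith
      _ = 2 * σ ^ 2 / min 1 v₀ * (1 * min 1 v₀) := by field_simp
      _ ≤ _ := by gcongr

/-- The first threshold is of the order of the rate. -/
theorem sq_threshold_le {ν σ M v r τ L c₁ lam T : ℝ} (hν : ν < 1) (hν0 : 0 < ν) (hv : 0 < v)
    (hr : r ≤ τ ^ 2) (hL : 0 ≤ L) (hlam : lam = lamStar σ M v r L ν)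
    (hT : T = max (c₁ * lam) (2 * M * v ^ (1 / 2 : ℝ) * τ / ν)) :
    T ^ 2 / v ≤ (c₁ ^ 2 * (σ ^ 2 * (M ^ 2 + 2)) + 4 * M ^ 2 / ν ^ 2) * max (L / v) (τ ^ 2) := by
  set R := max (L / v) (τ ^ 2) with hR
  have hR0 : 0 ≤ R := (sq_nonneg τ).trans (le_max_right _ _)
  have hLR : L ≤ R * v := (div_le_iff₀ hv).1 (le_max_left _ _)
  have hlam2 : lam ^ 2 ≤ σ ^ 2 * (M ^ 2 + 2) * (R * v) := by
    rw [hlam, lamStar, mul_pow, Real.sq_sqrt (le_max_of_le_right (by positivity)),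
      mul_assoc (σ ^ 2)]
    refine mul_le_mul_of_nonneg_left (max_le ?_ ?_) (sq_nonneg σ)
    · have h1 : r ≤ R := hr.trans (le_max_right _ _)
      calc M ^ 2 * v * r ≤ M ^ 2 * v * R := by gcongr
        _ = M ^ 2 * (R * v) := by ring
        _ ≤ (M ^ 2 + 2) * (R * v) := by gcongr; linarith
    · calc L * (1 + ν) ≤ (R * v) * 2 := by gcongr; linarith
        _ ≤ (M ^ 2 + 2) * (R * v) := by nlinarith [sq_nonneg M, mul_nonneg hR0 hv.le]
  have h2 : (c₁ * lam) ^ 2 ≤ c₁ ^ 2 * (σ ^ 2 * (M ^ 2 + 2)) * (R * v) := by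
    rw [mul_pow, mul_assoc (c₁ ^ 2)]
    gcongr
  have h3 : (2 * M * v ^ (1 / 2 : ℝ) * τ / ν) ^ 2 ≤ 4 * M ^ 2 / ν ^ 2 * (R * v) := by
    have h4 : (v ^ (1 / 2 : ℝ)) ^ 2 = v := by
      rw [← Real.sqrt_eq_rpow, Real.sq_sqrt hv.le]
    have h5 : τ ^ 2 ≤ R := le_max_right _ _
    calc (2 * M * v ^ (1 / 2 : ℝ) * τ / ν) ^ 2
        = 4 * M ^ 2 / ν ^ 2 * (τ ^ 2 * (v ^ (1 / 2 : ℝ)) ^ 2) := by ring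
      _ ≤ _ := by rw [h4]; gcongr
  rw [div_le_iff₀ hv]
  have h6 : 0 ≤ c₁ ^ 2 * (σ ^ 2 * (M ^ 2 + 2)) * (R * v) := by positivity
  have h7 : 0 ≤ 4 * M ^ 2 / ν ^ 2 * (R * v) := by positivity
  rw [hT]
  rcases max_choice (c₁ * lam) (2 * M * v ^ (1 / 2 : ℝ) * τ / ν) with h | h <;> rw [h] <;>
    linarith

end Rate

end GRLOL

/-! ### The risk bound -/

theorem theorem1
    (ν : ℝ) (hν0 : 0 < ν) (hν1 : ν < 1)
    (σ : ℝ) (hσ : 0 < σ) (M : ℝ) (hM : 0 < M) (a : ℝ) (ha : 0 < a)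
    (v₀ : ℝ) (hv₀ : 0 < v₀)
    (c₁ c₂ : ℝ) (hc : c₂ < c₁) (hc₂ : 5 * Real.sqrt (GRLOL.kap ν) ≤ c₂) :
    ∃ C : ℝ, 0 < C ∧
      ∀ (q : ℝ), 0 < q → q ≤ 1 → 4 + ν ^ (-(1 / q)) ≤ c₁ →
      ∀ (n p : ℕ) (t : Fin p → ℕ), (∀ j, 1 ≤ t j) →
      ∀ (v b : ℝ), 0 < v → a < b → (1 < σ → v₀ ≤ v) →
      ∀ (nrm : GRLOL.Idx t → ℝ), (∀ l, a * v ≤ nrm l ∧ nrm l ≤ b * v) →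
      ∀ (X : Matrix (Fin n) (GRLOL.Idx t) ℝ),
        (∀ l, GRLOL.gram nrm X l l = 1) →
        GRLOL.tauStar (GRLOL.gram nrm X) ≤ ν →
      ∀ (β : GRLOL.Idx t → ℝ),
        (∑ j, GRLOL.groupNorm1 (fun l => Real.sqrt (nrm l) * β l) j ^ q
          ≤ M ^ q * v ^ (q / 2)) →
      ∀ (Ω : Type*) [MeasurableSpace Ω] (P : Measure Ω) [IsProbabilityMeasure P]
        (W : Fin n → Ω → ℝ),
        (∀ i, HasLaw (W i) (gaussianReal 0 (Real.toNNReal (σ ^ 2))) P) →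
        iIndepFun W P →
      ∀ (lam lam₁ lam₂ : ℝ),
        lam = GRLOL.lamStar σ M v (GRLOL.rStar (GRLOL.gram nrm X)) (GRLOL.sizeLog t) ν →
        lam₁ = max (c₁ * lam)
          (2 * M * v ^ (1 / 2 : ℝ) * GRLOL.tauStar (GRLOL.gram nrm X) / ν) →
        lam₂ = c₂ * lam →
        (p : ℝ) ≤ (GRLOL.cA M q c₁ ν)⁻¹ * v ^ (q / 2) * lam ^ (-q) *
          Real.exp (GRLOL.cB c₁ c₂ ν * lam ^ 2 *
            GRLOL.oneMinInv (GRLOL.rStar (GRLOL.gram nrm X))) →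
        Integrable (fun ω => ∑ l, (GRLOL.grlol ν lam₁ lam₂ nrm X
            (fun i => (X *ᵥ β) i + W i ω) l - β l) ^ 2) P ∧
        ∫ ω, (∑ l, (GRLOL.grlol ν lam₁ lam₂ nrm X
            (fun i => (X *ᵥ β) i + W i ω) l - β l) ^ 2) ∂P
          ≤ C * (max (GRLOL.sizeLog t / v)
              (GRLOL.tauStar (GRLOL.gram nrm X) ^ 2)) ^ (1 - q / 2) := by
  set K₀ := 1701 + 3200 * ((1 - ν) ^ 2)⁻¹ with hK₀
  set K₂ := 200 / 3 * max (max 1 M) (2 * σ ^ 2 / min 1 v₀) with hK₂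
  set K₃ := c₁ ^ 2 * (σ ^ 2 * (M ^ 2 + 2)) + 4 * M ^ 2 / ν ^ 2 with hK₃
  have hM1 : 0 < max 1 M := lt_max_of_lt_left one_pos
  have hK₀0 : 0 < K₀ := by positivity
  have hK₂0 : 0 < K₂ := mul_pos (by norm_num) (lt_max_of_lt_left hM1)
  have hK₃0 : 0 ≤ K₃ := by positivity
  -- `K₀` comes from the deterministic loss bound, `max 1 M` from the signal sum, `K₂` from the
  -- noise sum and `K₃` from comparing `T² / v` with the rate.
  refine ⟨K₀ / a * (max 1 M + K₂) * max 1 K₃, by positivity, ?_⟩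
  intro q hq0 hq1 hc₁ n p t ht v b hv hab hσv nrm hnrm X hΓ hτ β hβ Ω _ P _ W hW hind
    lam lam₁ lam₂ hlam hlam₁ hlam₂ hp
  set Γ := GRLOL.gram nrm X with hΓdef
  set τ := GRLOL.tauStar Γ with hτdef
  set L := GRLOL.sizeLog t with hLdef
  have hτ0 : 0 ≤ τ := GRLOL.tauStar_nonneg Γ
  have hR0 : 0 ≤ max (L / v) (τ ^ 2) := (sq_nonneg τ).trans (le_max_right _ _)
  -- Without groups the loss is an empty sum; with at least one, `t* ∨ log p ≥ 1`.
  rcases Nat.eq_zero_or_pos p with hp0 | hp0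
  · subst hp0
    have : IsEmpty (GRLOL.Idx t) := ⟨fun l => l.1.elim0⟩
    simp only [Finset.univ_eq_empty, Finset.sum_empty, integral_zero]
    exact ⟨integrable_zero _ _ _, by positivity⟩
  have hL : 1 ≤ L := by
    refine le_max_of_le_left ?_
    have : t ⟨0, hp0⟩ ≤ GRLOL.tStar t := Finset.le_sup (f := t) (Finset.mem_univ _)
    exact_mod_cast (ht _).trans this
  have hc5 : 5 ≤ c₁ := by
    have : 1 ≤ ν ^ (-(1 / q)) :=
      Real.one_le_rpow_of_pos_of_le_one_of_nonpos hν0 hν1.le (by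
        have : 0 < 1 / q := by positivity
        linarith)
    linarith
  have hlam2 : σ ^ 2 * (1 + ν) * L ≤ lam ^ 2 := by
    rw [hlam, GRLOL.lamStar, mul_pow, Real.sq_sqrt (le_max_of_le_right (by positivity)), mul_assoc]
    refine mul_le_mul_of_nonneg_left ((le_of_eq (mul_comm _ _)).trans (le_max_right _ _))
      (sq_nonneg σ)
  have hlam0 : 0 < lam := by
    rw [hlam, GRLOL.lamStar]
    exact mul_pos hσ (Real.sqrt_pos.2 (lt_max_of_lt_right (by positivity)))
  have hTlam : c₁ * lam ≤ lam₁ := hlam₁ ▸ le_max_left _ _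
  have hT0 : 0 < lam₁ := lt_of_lt_of_le (by positivity) hTlam
  have hav : 0 < a * v := mul_pos ha hv
  have hH0 : 0 < M * v ^ (1 / 2 : ℝ) := by positivity
  have hHq : (M * v ^ (1 / 2 : ℝ)) ^ q = M ^ q * v ^ (q / 2) := by
    rw [Real.mul_rpow hM.le (by positivity), ← Real.rpow_mul hv.le]
    ring_nf
  set α : GRLOL.Idx t → ℝ := fun l => Real.sqrt (nrm l) * β l with hα
  have hH : ∑ j, GRLOL.groupNorm1 α j ≤ M * v ^ (1 / 2 : ℝ) :=
    GRLOL.sum_le_of_sum_rpow_le hq0 hq1 hH0 _ (GRLOL.groupNorm1_nonneg α) (by rwa [hHq])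
  have hc₂0 : 0 ≤ c₂ := le_trans (by positivity) hc₂
  have hl₂ : 0 ≤ lam₂ := hlam₂ ▸ mul_nonneg hc₂0 hlam0.le
  have hl₂T : lam₂ ≤ lam₁ := by rw [hlam₂]; nlinarith
  set s : ℝ≥0 := Real.toNNReal (σ ^ 2) with hs
  have hsσ : (s : ℝ) = σ ^ 2 := Real.coe_toNNReal _ (sq_nonneg σ)
  have hs0 : s ≠ 0 := by
    rw [hs, Ne, Real.toNNReal_eq_zero]
    push Not
    positivity
  set μ := Measure.pi (fun _ : Fin n => gaussianReal 0 s) with hμ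
  -- The loss is a measurable function of the noise vector, so the risk can be computed under the
  -- product Gaussian law.
  have hlaw : HasLaw (fun ω i => W i ω) μ P := hind.hasLaw_pi hW
  set F : (Fin n → ℝ) → ℝ := fun w => ∑ l, (GRLOL.grlol ν lam₁ lam₂ nrm X
    (fun i => (X *ᵥ β) i + w i) l - β l) ^ 2 with hF
  have hFm : Measurable F := Finset.measurable_sum _ fun l _ =>
    (((GRLOL.measurable_grlol ν lam₁ lam₂ nrm X l).comp
      (measurable_pi_lambda _ fun k => by fun_prop)).sub_const _).pow_const 2
  set A := ∑ j, min (GRLOL.groupNorm2 α j) lam₁ ^ 2 with hA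
  set Z : Fin p → (Fin n → ℝ) → ℝ := fun j w =>
    GRLOL.tailSq (9 / 20 * lam₁) (GRLOL.groupNorm2 (GRLOL.corr nrm X w) j) with hZ
  have hbound : ∀ᵐ w ∂μ, F w ≤ K₀ / (a * v) * (A + ∑ j, Z j w) := by
    filter_upwards [GRLOL.ae_groupNorm2_corr_ne ht nrm X hΓ (hτ.trans_lt hν1) (X *ᵥ β) s hs0]
      with w hw
    refine GRLOL.loss_le hav (fun l => (hnrm l).1) X hΓ hν0 hν1 hτ β w hH hT0 ?_ hl₂ hl₂T ?_
    · rw [hlam₁, ← mul_assoc 2 M]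
      exact le_max_right _ _
    · have hcard := GRLOL.card_leaders_le (N := GRLOL.numLeaders p ν τ) (l := lam₁) hw
      rcases eq_or_ne τ 0 with h0 | h0
      · rw [← hτdef, h0, mul_zero]
        exact hν0.le
      · have hτp : 0 < τ := lt_of_le_of_ne hτ0 h0.symm
        rw [← le_div_iff₀ hτp]
        have h1 : (GRLOL.numLeaders p ν τ : ℝ) ≤ ν / τ := by
          rw [GRLOL.numLeaders, if_neg h0]
          exact Nat.floor_le (by positivity)
        exact le_trans (by exact_mod_cast hcard) h1
  have hZint := fun j => GRLOL.integral_tailSq_le nrm X hΓ hν0 hτ s hs0 (9 / 20 * lam₁) j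
  have hGint : Integrable (fun w => K₀ / (a * v) * (A + ∑ j, Z j w)) μ :=
    ((integrable_const A).add (integrable_finsetSum _ fun j _ => (hZint j).1)).const_mul _
  have hF0 : ∀ w, 0 ≤ F w := fun w => Finset.sum_nonneg fun _ _ => sq_nonneg _
  have hFint : Integrable F μ := hGint.mono' hFm.aestronglyMeasurable (by
    filter_upwards [hbound] with w hw
    rwa [Real.norm_of_nonneg (hF0 w)])
  have hFmap : AEStronglyMeasurable F (P.map fun ω i => W i ω) := hFm.aestronglyMeasurable
  have hPint : Integrable (fun ω => F fun i => W i ω) P :=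
    (integrable_map_measure hFmap hlaw.aemeasurable).1 (hlaw.map_eq ▸ hFint)
  refine ⟨hPint, ?_⟩
  have hint : ∫ ω, F (fun i => W i ω) ∂P = ∫ w, F w ∂μ := by
    rw [← hlaw.map_eq, integral_map hlaw.aemeasurable hFmap]
  change ∫ ω, F (fun i => W i ω) ∂P ≤ _
  rw [hint]
  have hAle : A ≤ max 1 M * (lam₁ ^ (2 - q) * v ^ (q / 2)) := by
    calc A ≤ ∑ j, lam₁ ^ (2 - q) * GRLOL.groupNorm1 α j ^ q := Finset.sum_le_sum fun j _ =>
          GRLOL.min_sq_le_rpow (GRLOL.groupNorm2_nonneg _ _)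
            (GRLOL.groupNorm2_le_groupNorm1 α j) hT0 hq0 hq1
      _ ≤ lam₁ ^ (2 - q) * (M ^ q * v ^ (q / 2)) := by
          rw [← Finset.mul_sum]
          gcongr
      _ ≤ lam₁ ^ (2 - q) * (max 1 M * v ^ (q / 2)) := by
          gcongr
          exact GRLOL.rpow_le_max_one hM.le hq0.le hq1
      _ = _ := by ring
  have hZle : ∑ j, ∫ w, Z j w ∂μ ≤ K₂ * (lam₁ ^ (2 - q) * v ^ (q / 2)) := by
    have htail := GRLOL.card_mul_tail_le (p := p) (k := GRLOL.tStar t) hν0 hν1 hσ hM hv hv₀ hσv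
      hq0 hq1 hc5 hL hp0 (le_max_right _ _) (le_max_left _ _) hlam0 hlam2 hTlam
      (GRLOL.oneMinInv_le_one _) hp
    refine le_trans ?_ htail
    calc ∑ j, ∫ w, Z j w ∂μ ≤ ∑ _j : Fin p, 200 / 3 * (σ ^ 2 * (1 + ν)) *
          Real.exp (-(9 / 25) * ((9 / 20 * lam₁) ^ 2 / (σ ^ 2 * (1 + ν)))) *
            2 ^ GRLOL.tStar t := by
          refine Finset.sum_le_sum fun j _ => ?_
          have h1 := (hZint j).2
          rw [hsσ] at h1
          refine h1.trans ?_
          gcongr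
          · norm_num
          · exact Finset.le_sup (f := t) (Finset.mem_univ j)
      _ = _ := by simp
  have hrate : (lam₁ ^ (2 - q) * v ^ (q / 2)) / v ≤
      max 1 K₃ * (max (L / v) (τ ^ 2)) ^ (1 - q / 2) := by
    have h1 : (lam₁ ^ (2 - q) * v ^ (q / 2)) / v = (lam₁ ^ 2 / v) ^ (1 - q / 2) := by
      rw [Real.div_rpow (by positivity) hv.le, ← Real.rpow_natCast lam₁ 2, ← Real.rpow_mul hT0.le,
        Real.rpow_sub hv, Real.rpow_one, div_div_eq_mul_div]
      push_cast
      ring_nf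
    rw [h1]
    calc (lam₁ ^ 2 / v) ^ (1 - q / 2) ≤ (K₃ * max (L / v) (τ ^ 2)) ^ (1 - q / 2) :=
          Real.rpow_le_rpow (by positivity) (GRLOL.sq_threshold_le hν1 hν0 hv
            (GRLOL.rStar_le_tauStar_sq Γ) (by linarith) hlam hlam₁) (by linarith)
      _ = K₃ ^ (1 - q / 2) * (max (L / v) (τ ^ 2)) ^ (1 - q / 2) := Real.mul_rpow hK₃0 hR0
      _ ≤ _ := by
          gcongr
          exact GRLOL.rpow_le_max_one hK₃0 (by linarith) (by linarith)
  calc ∫ w, F w ∂μ ≤ ∫ w, K₀ / (a * v) * (A + ∑ j, Z j w) ∂μ :=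
        integral_mono_ae hFint hGint hbound
    _ = K₀ / (a * v) * (A + ∑ j, ∫ w, Z j w ∂μ) := by
        rw [integral_const_mul, integral_add (integrable_const A)
          (integrable_finsetSum _ fun j _ => (hZint j).1),
          integral_finsetSum _ fun j _ => (hZint j).1, integral_const,
          probReal_univ, one_smul]
    _ ≤ K₀ / (a * v) * (max 1 M * (lam₁ ^ (2 - q) * v ^ (q / 2)) +
          K₂ * (lam₁ ^ (2 - q) * v ^ (q / 2))) := by gcongr
    _ = K₀ / a * (max 1 M + K₂) * ((lam₁ ^ (2 - q) * v ^ (q / 2)) / v) := by field_simp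
    _ ≤ K₀ / a * (max 1 M + K₂) * (max 1 K₃ * (max (L / v) (τ ^ 2)) ^ (1 - q / 2)) := by gcongr
    _ = _ := by ring
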